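/- Let $\Omega\subset\mathbb{R}^3$ be a non-empty open set (for instance a possibly unbounded Lipschitz domain). Let $\varepsilon,\mu,\sigma\in L^\infty(\Omega,\mathbb{R}^{3\times3})$ be symmetric matrix-valued functions and let $\varepsilon_{\min},\varepsilon_{\max},\mu_{\min},\mu_{\max},\sigma_{\min},\sigma_{\max}$ be real constants such that, almost everywhere in $\Omega$ and for all $\eta\in\mathbb{R}^3$ with $|\eta|=1$, $$0<\varepsilon_{\min}\le\eta\cdot\varepsilon\eta\le\varepsilon_{\max},\qquad 0<\mu_{\min}\le\eta\cdot\mu\eta\le\mu_{\max},\qquad 0\le\sigma_{\min}\le\eta\cdot\sigma\eta\le\sigma_{\max}.$$ Let $\operatorname{curl}$ be the distributional curl in $L^2(\Omega)^3=L^2(\Omega,\mathbb{C}^3)$ with domain $H(\operatorname{curl},\Omega)=\{u\in L^2(\Omega)^3:\operatorname{curl}u\in L^2(\Omega)^3\}$, and let $\operatorname{curl}_0=\operatorname{curl}^*$ be its adjoint. The operator $\operatorname{curl}_0$ is the restriction of $\operatorname{curl}$ to $$H_0(\operatorname{curl},\Omega)=\{u\in H(\operatorname{curl},\Omega):\langle\operatorname{curl}u,v\rangle=\langle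 u,\operatorname{curl}v\rangle\ \text{for all } v\in H(\operatorname{curl},\Omega)\},$$ which for a Lipschitz domain is the space of fields in $H(\operatorname{curl},\Omega)$ with vanishing tangential trace $\nu\times u|_{\partial\Omega}=0$. Let $H(\operatorname{div}0,\Omega)=\{u\in L^2(\Omega)^3:\operatorname{div}u=0\}$. For $\omega\in\mathbb{C}$ let $V(\omega)$ be the operator in $L^2(\Omega)^3\oplus L^2(\Omega)^3$ given by $$V(\omega)=\begin{pmatrix}-\mathrm{i}\sigma&\mathrm{i}\operatorname{curl}\\-\mathrm{i}\operatorname{curl}_0&0\end{pmatrix}-\omega\begin{pmatrix}\varepsilon&0\\0&\mu\end{pmatrix},\qquad\operatorname{dom}V(\omega)=H_0(\operatorname{curl},\Omega)\oplus H(\operatorname{curl},\Omega),$$ and let $\sigma(V)$ be the set of all $\omega\in\mathbb{C}$ for which $V(\omega)$ is not a bijection of its domain onto $L^2(\Omega)^3\oplus L^2(\Omega)^3$ with bounded inverse. Then the following hold. (0) The spectrum of $\operatorname{curl}\operatorname{curl}_0$ restricted to the Hilbert space $H(\operatorname{div}0,\Omega)$ is real and has a minimum, $\lambda^\Omega_{\min}:=\min\sigma(\operatorname{curl}\operatorname{curl}_0|_{H(\operatorname{div}0,\Omega)})$,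 and $\lambda^\Omega_{\min}\ge0$. (1) The spectrum of $V$ satisfies $$\sigma(V)\subset\mathrm{i}\Big[-\frac{\sigma_{\max}}{\varepsilon_{\min}},0\Big]\cup\Big\{\omega\in\mathbb{C}\setminus\mathrm{i}\mathbb{R}:\ \operatorname{Im}\omega\in\Big[-\frac12\frac{\sigma_{\max}}{\varepsilon_{\min}},-\frac12\frac{\sigma_{\min}}{\varepsilon_{\max}}\Big],\ (\operatorname{Re}\omega)^2-3(\operatorname{Im}\omega)^2+2\frac{\sigma_{\max}}{\varepsilon_{\min}}|\operatorname{Im}\omega|\ge\frac{\lambda^\Omega_{\min}}{\varepsilon_{\max}\mu_{\max}}\Big\}.$$ (2) If $\lambda^\Omega_{\min}>0$, then, with $r=\big(\lambda^\Omega_{\min}/(\varepsilon_{\max}\mu_{\max})\big)^{1/2}$, the spectrum $\sigma(V)$ contains no point of the real set $(-r,0)\cup(0,r)$. (3) If $\lambda^\Omega_{\min}>\dfrac13\dfrac{\sigma_{\max}^2\varepsilon_{\max}\mu_{\max}}{\varepsilon_{\min}^2}$, then $\sigma(V)\cap\mathrm{i}\mathbb{R}\subset\mathrm{i}\big[-\frac{\sigma_{\max}}{\varepsilon_{\min}},0\big]$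 is isolated from $\sigma(V)\setminus\mathrm{i}\mathbb{R}$: there is $\delta>0$ such that $|z-w|\ge\delta$ for all $z\in\sigma(V)\cap\mathrm{i}\mathbb{R}$ and all $w\in\sigma(V)\setminus\mathrm{i}\mathbb{R}$. -/

import Mathlib

open MeasureTheory

open scoped InnerProductSpace

noncomputable section

namespace Maxwell

/-! ### Function spaces -/

/-- Physical space with its Euclidean norm. -/
abbrev R3 : Type := EuclideanSpace ℝ (Fin 3)

/-- The values of the (complex) vector fields, with the Hermitian inner product. -/
abbrev C3 : Type := EuclideanSpace ℂ (Fin 3)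

/-- Lebesgue measure on the open set `Ω`. -/
abbrev vol (Ω : TopologicalSpace.Opens R3) : Measure R3 := volume.restrict (Ω : Set R3)

/-- The Hilbert space `L²(Ω)³` of complex vector fields. -/
abbrev L2 (Ω : TopologicalSpace.Opens R3) : Type := Lp C3 2 (vol Ω)

/-- The Hilbert space `L²(Ω)³ ⊕ L²(Ω)³`; its elements are the pairs `(E, H)`. -/
abbrev L2Pair (Ω : TopologicalSpace.Opens R3) : Type := WithLp 2 (L2 Ω × L2 Ω)

/-- `φ ∈ C_c^∞(Ω; F)`. -/
structure IsTest (Ω : TopologicalSpace.Opens R3) {F : Type} [NormedAddCommGroup F]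
    [NormedSpace ℝ F] (φ : R3 → F) : Prop where
  smooth : ContDiff ℝ (⊤ : ℕ∞) φ
  compact : HasCompactSupport φ
  support : tsupport φ ⊆ (Ω : Set R3)

/-- The partial derivative `∂ⱼ φ` at `x`. -/
def partialD {F : Type} [NormedAddCommGroup F] [NormedSpace ℝ F] (j : Fin 3) (φ : R3 → F)
    (x : R3) : F :=
  fderiv ℝ φ x (EuclideanSpace.single j 1)

/-- The classical curl of a differentiable vector field. -/
def classicalCurl (φ : R3 → C3) (x : R3) : C3 :=
  !₂[partialD 1 φ x 2 - partialD 2 φ x 1,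
     partialD 2 φ x 0 - partialD 0 φ x 2,
     partialD 0 φ x 1 - partialD 1 φ x 0]

/-- The classical gradient of a differentiable scalar function. -/
def classicalGrad (φ : R3 → ℂ) (x : R3) : C3 :=
  WithLp.toLp 2 (fun j => partialD j φ x)

/-- `w = curl u` in `Ω` in the sense of distributions. -/
def IsWeakCurl (Ω : TopologicalSpace.Opens R3) (u w : L2 Ω) : Prop :=
  ∀ φ : R3 → C3, IsTest Ω φ →
    ∫ x in (Ω : Set R3), ⟪classicalCurl φ x, u x⟫_ℂ = ∫ x in (Ω : Set R3), ⟪φ x, w x⟫_ℂ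

/-- `div u = 0` in `Ω` in the sense of distributions. -/
def IsWeakDivFree (Ω : TopologicalSpace.Opens R3) (u : L2 Ω) : Prop :=
  ∀ φ : R3 → ℂ, IsTest Ω φ → ∫ x in (Ω : Set R3), ⟪classicalGrad φ x, u x⟫_ℂ = 0

/-! ### Facts on test functions -/

section TestFacts

variable {Ω : TopologicalSpace.Opens R3}

theorem IsTest.partialD {F : Type} [NormedAddCommGroup F] [NormedSpace ℝ F] {φ : R3 → F}
    (h : IsTest Ω φ) (j : Fin 3) : IsTest Ω (partialD j φ) := by
  have hs : Function.support (Maxwell.partialD j φ) ⊆ tsupport φ := by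
    intro x hx
    by_contra hn
    apply hx
    have : fderiv ℝ φ x = 0 := by
      by_contra h0
      exact hn (support_fderiv_subset ℝ (f := φ) h0)
    simp [Maxwell.partialD, this]
  refine ⟨?_, ?_, ?_⟩
  · exact (h.smooth.fderiv_right (m := ((⊤ : ℕ∞) : WithTop ℕ∞)) (by simp)).clm_apply contDiff_const
  · exact HasCompactSupport.mono' h.compact hs
  · exact (closure_minimal hs (isClosed_tsupport φ)).trans h.support

theorem IsTest.clm {F G : Type} [NormedAddCommGroup F] [NormedSpace ℝ F]
    [NormedAddCommGroup G] [NormedSpace ℝ G] {φ : R3 → F} (h : IsTest Ω φ) (L : F →L[ℝ] G) :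
    IsTest Ω (fun x => L (φ x)) := by
  have hs : Function.support (fun x => L (φ x)) ⊆ Function.support φ := by
    intro x hx h0
    exact hx (by simp only [h0, map_zero])
  exact ⟨L.contDiff.comp h.smooth, h.compact.mono hs, (closure_mono hs).trans h.support⟩

theorem IsTest.sub {F : Type} [NormedAddCommGroup F] [NormedSpace ℝ F] {φ ψ : R3 → F}
    (h : IsTest Ω φ) (h' : IsTest Ω ψ) : IsTest Ω (fun x => φ x - ψ x) := by
  have hs : Function.support (fun x => φ x - ψ x) ⊆ tsupport φ ∪ tsupport ψ := by
    intro x hx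
    by_contra hn
    rw [Set.mem_union, not_or] at hn
    exact hx (by simp [image_eq_zero_of_notMem_tsupport hn.1,
      image_eq_zero_of_notMem_tsupport hn.2])
  have hc : tsupport (fun x => φ x - ψ x) ⊆ tsupport φ ∪ tsupport ψ :=
    closure_minimal hs ((isClosed_tsupport φ).union (isClosed_tsupport ψ))
  exact ⟨h.smooth.sub h'.smooth,
    (h.compact.isCompact.union h'.compact.isCompact).of_isClosed_subset (isClosed_tsupport _) hc,
    hc.trans (Set.union_subset h.support h'.support)⟩

theorem isTest_toLp {φ : R3 → Fin 3 → ℂ} (h : ∀ i, IsTest Ω (fun x => φ x i)) :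
    IsTest Ω (fun x => (WithLp.toLp 2 (φ x) : C3)) := by
  have hs : Function.support (fun x => (WithLp.toLp 2 (φ x) : C3)) ⊆
      ⋃ i, tsupport (fun x => φ x i) := by
    intro x hx
    by_contra hn
    rw [Set.mem_iUnion, not_exists] at hn
    apply hx
    ext i
    simpa using image_eq_zero_of_notMem_tsupport (hn i)
  have hcl : IsClosed (⋃ i, tsupport (fun x => φ x i)) :=
    isClosed_iUnion_of_finite fun i => isClosed_tsupport _
  have hc := closure_minimal hs hcl
  refine ⟨?_, ?_, hc.trans (Set.iUnion_subset fun i => (h i).support)⟩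
  · exact PiLp.contDiff_toLp.comp (contDiff_pi.2 fun i => (h i).smooth)
  · exact (isCompact_iUnion fun i => (h i).compact.isCompact).of_isClosed_subset
      (isClosed_tsupport _) hc

theorem IsTest.coord {φ : R3 → C3} (h : IsTest Ω φ) (i : Fin 3) : IsTest Ω (fun x => φ x i) :=
  h.clm ((EuclideanSpace.proj i : C3 →L[ℂ] ℂ).restrictScalars ℝ)

theorem IsTest.classicalCurl {φ : R3 → C3} (h : IsTest Ω φ) : IsTest Ω (classicalCurl φ) := by
  refine isTest_toLp (φ := fun x => ![_, _, _]) fun i => ?_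
  fin_cases i
  · exact ((h.partialD 1).coord 2).sub ((h.partialD 2).coord 1)
  · exact ((h.partialD 2).coord 0).sub ((h.partialD 0).coord 2)
  · exact ((h.partialD 0).coord 1).sub ((h.partialD 1).coord 0)

theorem IsTest.classicalGrad {φ : R3 → ℂ} (h : IsTest Ω φ) : IsTest Ω (classicalGrad φ) :=
  isTest_toLp fun i => h.partialD i

theorem IsTest.memLp {φ : R3 → C3} (h : IsTest Ω φ) : MemLp φ 2 (vol Ω) :=
  h.smooth.continuous.memLp_of_hasCompactSupport h.compact

/-- A test field as an element of `L²(Ω)³`. -/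
def IsTest.toL2 {φ : R3 → C3} (h : IsTest Ω φ) : L2 Ω := h.memLp.toLp φ

theorem inner_toL2 {φ : R3 → C3} (h : IsTest Ω φ) (u : L2 Ω) :
    ⟪h.toL2, u⟫_ℂ = ∫ x in (Ω : Set R3), ⟪φ x, u x⟫_ℂ := by
  rw [L2.inner_def]
  refine integral_congr_ae ?_
  filter_upwards [h.memLp.coeFn_toLp] with x hx
  rw [IsTest.toL2, hx]

theorem isWeakCurl_iff {u w : L2 Ω} :
    IsWeakCurl Ω u w ↔
      ∀ (φ : R3 → C3) (h : IsTest Ω φ), ⟪h.classicalCurl.toL2, u⟫_ℂ = ⟪h.toL2, w⟫_ℂ := by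
  simp only [inner_toL2]
  rfl

theorem isWeakDivFree_iff {u : L2 Ω} :
    IsWeakDivFree Ω u ↔ ∀ (φ : R3 → ℂ) (h : IsTest Ω φ), ⟪h.classicalGrad.toL2, u⟫_ℂ = 0 := by
  simp only [inner_toL2]
  rfl

/-- An `L²` field that is orthogonal to all test fields vanishes. -/
theorem eq_zero_of_forall_test {w : L2 Ω}
    (hw : ∀ (φ : R3 → C3) (h : IsTest Ω φ), ⟪h.toL2, w⟫_ℂ = 0) : w = 0 := by
  have hcomp : ∀ i : Fin 3, ∀ᵐ x, x ∈ (Ω : Set R3) → (w x) i = 0 := by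
    intro i
    have hwi : MemLp (fun x => (w x) i) 2 (vol Ω) :=
      (EuclideanSpace.proj i : C3 →L[ℂ] ℂ).comp_memLp' (Lp.memLp w)
    refine Ω.isOpen.ae_eq_zero_of_integral_contDiff_smul_eq_zero ?_ ?_
    · refine locallyIntegrableOn_of_locallyIntegrable_restrict ?_
      exact hwi.locallyIntegrable (by norm_num)
    · intro g hg hgc hgs
      have hgt : IsTest Ω g := ⟨hg, hgc, hgs⟩
      have ht : IsTest Ω (fun x => (g x : ℝ) • (EuclideanSpace.single i (1 : ℂ) : C3)) :=
        hgt.clm ((ContinuousLinearMap.id ℝ ℝ).smulRight (EuclideanSpace.single i (1 : ℂ) : C3))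
      have := hw _ ht
      rw [inner_toL2] at this
      rw [← this, ← setIntegral_eq_integral_of_forall_compl_eq_zero (s := (Ω : Set R3))]
      · refine integral_congr_ae (Filter.Eventually.of_forall fun x => ?_)
        simp only [PiLp.inner_apply, Fin.sum_univ_three]
        fin_cases i <;> simp [mul_comm]
      · intro x hx
        rw [image_eq_zero_of_notMem_tsupport (fun h => hx (hgs h)), zero_smul]
  rw [Lp.eq_zero_iff_ae_eq_zero]
  rw [Filter.EventuallyEq, ae_restrict_iff' Ω.isOpen.measurableSet]
  filter_upwards [hcomp 0, hcomp 1, hcomp 2] with x h0 h1 h2 hx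
  ext i
  fin_cases i
  · simpa using h0 hx
  · simpa using h1 hx
  · simpa using h2 hx

theorem partialD_coord {φ : R3 → C3} (h : IsTest Ω φ) (j i : Fin 3) (x : R3) :
    partialD j (fun y => φ y i) x = partialD j φ x i := by
  have hd : HasFDerivAt φ (fderiv ℝ φ x) x :=
    (h.smooth.differentiable (by simp) x).hasFDerivAt
  have := ((EuclideanSpace.proj i : C3 →L[ℂ] ℂ).restrictScalars ℝ).hasFDerivAt.comp x hd
  simp only [partialD]
  erw [this.fderiv]
  rfl

/-- Integration by parts for scalar test functions. -/
theorem integral_partialD {f g : R3 → ℂ} (hf : IsTest Ω f) (hg : IsTest Ω g) (j : Fin 3) :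
    ∫ x, (starRingEnd ℂ) (partialD j f x) * g x = - ∫ x, (starRingEnd ℂ) (f x) * partialD j g x := by
  have hint : ∀ {a b : R3 → ℂ}, IsTest Ω a → IsTest Ω b →
      Integrable (fun x => (starRingEnd ℂ) (a x) * b x) := by
    intro a b ha hb
    refine Continuous.integrable_of_hasCompactSupport ?_ hb.compact.mul_left
    exact (Complex.continuous_conj.comp ha.smooth.continuous).mul hb.smooth.continuous
  have := integral_bilinear_fderiv_right_eq_neg_left_of_integrable (μ := (volume : Measure R3))
    (f := f) (g := g) (v := EuclideanSpace.single j 1)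
    (B := (ContinuousLinearMap.mul ℝ ℂ).comp (Complex.conjCLE : ℂ →L[ℝ] ℂ))
    (by simpa [partialD] using hint (hf.partialD j) hg) (by simpa [partialD] using hint hf (hg.partialD j))
    (by simpa using hint hf hg) (fun x _ => hf.smooth.differentiable (by simp) x)
    (fun x _ => hg.smooth.differentiable (by simp) x)
  simp only [ContinuousLinearMap.comp_apply, ContinuousLinearMap.mul_apply',
    ContinuousLinearEquiv.coe_coe, Complex.conjCLE_apply] at this
  simp only [partialD]
  rw [this, neg_neg]

theorem integral_six {a b c d e f : R3 → ℂ} (ha : Integrable a) (hb : Integrable b)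
    (hc : Integrable c) (hd : Integrable d) (he : Integrable e) (hf : Integrable f) :
    ∫ x, ((a x - b x + (c x - d x)) + (e x - f x)) =
      ((∫ x, a x) - (∫ x, b x) + ((∫ x, c x) - ∫ x, d x)) + ((∫ x, e x) - ∫ x, f x) := by
  have h1 : Integrable (fun x => a x - b x) := ha.sub hb
  have h2 : Integrable (fun x => c x - d x) := hc.sub hd
  have h3 : Integrable (fun x => e x - f x) := he.sub hf
  have h4 : Integrable (fun x => a x - b x + (c x - d x)) := h1.add h2
  rw [integral_add h4 h3, integral_add h1 h2, integral_sub ha hb, integral_sub hc hd,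
    integral_sub he hf]

/-- On test fields the distributional curl is the classical one. -/
theorem IsTest.isWeakCurl {φ : R3 → C3} (h : IsTest Ω φ) :
    IsWeakCurl Ω h.toL2 h.classicalCurl.toL2 := by
  intro ψ hψ
  have e1 : ∫ x in (Ω : Set R3), ⟪Maxwell.classicalCurl ψ x, h.toL2 x⟫_ℂ =
      ∫ x, ⟪Maxwell.classicalCurl ψ x, φ x⟫_ℂ := by
    refine (integral_congr_ae ?_).trans (setIntegral_eq_integral_of_forall_compl_eq_zero ?_)
    · change _ =ᵐ[vol Ω] _
      filter_upwards [h.memLp.coeFn_toLp] with x hx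
      rw [IsTest.toL2, hx]
    · intro x hx
      rw [image_eq_zero_of_notMem_tsupport (fun h' => hx (h.support h')), inner_zero_right]
  have e2 : ∫ x in (Ω : Set R3), ⟪ψ x, h.classicalCurl.toL2 x⟫_ℂ =
      ∫ x, ⟪ψ x, Maxwell.classicalCurl φ x⟫_ℂ := by
    refine (integral_congr_ae ?_).trans (setIntegral_eq_integral_of_forall_compl_eq_zero ?_)
    · change _ =ᵐ[vol Ω] _
      filter_upwards [h.classicalCurl.memLp.coeFn_toLp] with x hx
      rw [IsTest.toL2, hx]
    · intro x hx
      rw [image_eq_zero_of_notMem_tsupport (fun h' => hx (hψ.support h')), inner_zero_left]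
  have hint : ∀ {a b : R3 → ℂ}, IsTest Ω a → IsTest Ω b →
      Integrable (fun x => (starRingEnd ℂ) (a x) * b x) := by
    intro a b ha hb
    refine Continuous.integrable_of_hasCompactSupport ?_ hb.compact.mul_left
    exact (Complex.continuous_conj.comp ha.smooth.continuous).mul hb.smooth.continuous
  have i1 : ∀ j k l : Fin 3,
      Integrable (fun x => (starRingEnd ℂ) (Maxwell.partialD j ψ x k) * φ x l) :=
    fun j k l => hint ((hψ.partialD j).coord k) (h.coord l)
  have i2 : ∀ j k l : Fin 3,
      Integrable (fun x => (starRingEnd ℂ) (ψ x k) * Maxwell.partialD j φ x l) :=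
    fun j k l => hint (hψ.coord k) ((h.partialD j).coord l)
  have ibp : ∀ j k l : Fin 3,
      ∫ x, (starRingEnd ℂ) (Maxwell.partialD j ψ x k) * φ x l =
        - ∫ x, (starRingEnd ℂ) (ψ x k) * Maxwell.partialD j φ x l := by
    intro j k l
    have := integral_partialD (hψ.coord k) (h.coord l) j
    simpa only [partialD_coord hψ, partialD_coord h] using this
  have x1 : ∀ x, ⟪Maxwell.classicalCurl ψ x, φ x⟫_ℂ =
      (((starRingEnd ℂ) (Maxwell.partialD 1 ψ x 2) * φ x 0 -
        (starRingEnd ℂ) (Maxwell.partialD 2 ψ x 1) * φ x 0) +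
      ((starRingEnd ℂ) (Maxwell.partialD 2 ψ x 0) * φ x 1 -
        (starRingEnd ℂ) (Maxwell.partialD 0 ψ x 2) * φ x 1)) +
      ((starRingEnd ℂ) (Maxwell.partialD 0 ψ x 1) * φ x 2 -
        (starRingEnd ℂ) (Maxwell.partialD 1 ψ x 0) * φ x 2) := by
    intro x
    simp only [PiLp.inner_apply, Fin.sum_univ_three, Maxwell.classicalCurl, RCLike.inner_apply]
    simp
    ring
  have x2 : ∀ x, ⟪ψ x, Maxwell.classicalCurl φ x⟫_ℂ =
      (((starRingEnd ℂ) (ψ x 0) * Maxwell.partialD 1 φ x 2 -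
        (starRingEnd ℂ) (ψ x 0) * Maxwell.partialD 2 φ x 1) +
      ((starRingEnd ℂ) (ψ x 1) * Maxwell.partialD 2 φ x 0 -
        (starRingEnd ℂ) (ψ x 1) * Maxwell.partialD 0 φ x 2)) +
      ((starRingEnd ℂ) (ψ x 2) * Maxwell.partialD 0 φ x 1 -
        (starRingEnd ℂ) (ψ x 2) * Maxwell.partialD 1 φ x 0) := by
    intro x
    simp only [PiLp.inner_apply, Fin.sum_univ_three, Maxwell.classicalCurl, RCLike.inner_apply]
    simp
    ring
  rw [e1, e2]
  simp only [x1, x2]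
  rw [integral_six (i1 _ _ _) (i1 _ _ _) (i1 _ _ _) (i1 _ _ _) (i1 _ _ _) (i1 _ _ _),
    integral_six (i2 _ _ _) (i2 _ _ _) (i2 _ _ _) (i2 _ _ _) (i2 _ _ _) (i2 _ _ _)]
  simp only [ibp]
  ring

/-- The curl of a gradient vanishes. -/
theorem IsTest.curl_grad {φ : R3 → ℂ} (h : IsTest Ω φ) (x : R3) :
    Maxwell.classicalCurl (Maxwell.classicalGrad φ) x = 0 := by
  have hc : ∀ j i : Fin 3, Maxwell.partialD j (Maxwell.classicalGrad φ) x i =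
      fderiv ℝ (fderiv ℝ φ) x (EuclideanSpace.single j 1) (EuclideanSpace.single i 1) := by
    intro j i
    rw [← partialD_coord h.classicalGrad]
    have hd : DifferentiableAt ℝ (fderiv ℝ φ) x :=
      ((h.smooth.fderiv_right (m := 1) (by norm_cast)).differentiable (by simp)) x
    change fderiv ℝ (fun y => fderiv ℝ φ y (EuclideanSpace.single i 1)) x _ = _
    rw [fderiv_clm_apply hd (differentiableAt_const _)]
    simp
  have hsymm : IsSymmSndFDerivAt ℝ φ x :=
    h.smooth.contDiffAt.isSymmSndFDerivAt (by
      rw [minSmoothness_of_isRCLikeNormedField]; exact WithTop.coe_le_coe.2 le_top)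
  have hz : ∀ j i : Fin 3, Maxwell.partialD j (Maxwell.classicalGrad φ) x i -
      Maxwell.partialD i (Maxwell.classicalGrad φ) x j = 0 := by
    intro j i
    rw [hc, hc, hsymm.eq, sub_self]
  simp only [Maxwell.classicalCurl, hz]
  ext i
  fin_cases i <;> rfl

end TestFacts

/-! ### The operators `curl` and `curl₀` -/

section Operators

variable (Ω : TopologicalSpace.Opens R3)

/-- The graph of the distributional curl in `L²(Ω)³`. -/
def curlGraph : Submodule ℂ (L2 Ω × L2 Ω) where
  carrier := {p | IsWeakCurl Ω p.1 p.2}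
  zero_mem' := by
    rw [Set.mem_ofPred_eq, isWeakCurl_iff]
    intro φ h
    simp
  add_mem' := by
    intro p q hp hq
    rw [Set.mem_ofPred_eq, isWeakCurl_iff] at *
    intro φ h
    simp [inner_add_right, hp φ h, hq φ h]
  smul_mem' := by
    intro c p hp
    rw [Set.mem_ofPred_eq, isWeakCurl_iff] at *
    intro φ h
    simp [inner_smul_right, hp φ h]

/-- The operator `curl` in `L²(Ω)³` on its maximal domain
`H(curl, Ω) = {u ∈ L²(Ω)³ : curl u ∈ L²(Ω)³}`. -/
def curl : L2 Ω →ₗ.[ℂ] L2 Ω := (curlGraph Ω).toLinearPMap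

variable {Ω}

theorem curlGraph_functional (p : L2 Ω × L2 Ω) (hp : p ∈ curlGraph Ω) (h0 : p.1 = 0) :
    p.2 = 0 := by
  refine eq_zero_of_forall_test fun φ h => ?_
  have := isWeakCurl_iff.1 hp φ h
  rw [← this, h0, inner_zero_right]

theorem mem_curl_domain {u : L2 Ω} : u ∈ (curl Ω).domain ↔ ∃ w, IsWeakCurl Ω u w := by
  change u ∈ (curlGraph Ω).map (LinearMap.fst ℂ _ _) ↔ _
  simp [curlGraph]

theorem curl_spec (u : (curl Ω).domain) : IsWeakCurl Ω u (curl Ω u) :=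
  Submodule.mem_graph_toLinearPMap curlGraph_functional u

theorem curl_eq_of_isWeakCurl (u : (curl Ω).domain) {w : L2 Ω} (h : IsWeakCurl Ω u w) :
    curl Ω u = w := by
  have h1 : ((0 : L2 Ω), curl Ω u - w) ∈ curlGraph Ω := by
    have := (curlGraph Ω).sub_mem (show ((u : L2 Ω), curl Ω u) ∈ curlGraph Ω from curl_spec u)
      (show ((u : L2 Ω), w) ∈ curlGraph Ω from h)
    simpa using this
  exact sub_eq_zero.1 (curlGraph_functional _ h1 rfl)

theorem IsTest.mem_curl_domain {φ : R3 → C3} (h : IsTest Ω φ) : h.toL2 ∈ (curl Ω).domain :=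
  Maxwell.mem_curl_domain.2 ⟨_, h.isWeakCurl⟩

theorem curl_dense : Dense ((curl Ω).domain : Set (L2 Ω)) := by
  rw [Submodule.dense_iff_topologicalClosure_eq_top, Submodule.topologicalClosure_eq_top_iff,
    Submodule.eq_bot_iff]
  intro w hw
  exact eq_zero_of_forall_test fun φ h => (Submodule.mem_orthogonal _ _).1 hw _ h.mem_curl_domain

variable (Ω)

/-- The space `H₀(curl, Ω)` of the fields `u ∈ H(curl, Ω)` with vanishing tangential trace
`ν × u` on the boundary, the trace being understood weakly through Green's formula: the boundary
term `⟨curl u, v⟩ - ⟨u, curl v⟩` vanishes for all `v ∈ H(curl, Ω)`. -/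
def H0curl : Submodule ℂ (L2 Ω) where
  carrier := {u | ∃ hu : u ∈ (curl Ω).domain, ∀ v : (curl Ω).domain,
    ⟪curl Ω ⟨u, hu⟩, (v : L2 Ω)⟫_ℂ = ⟪u, curl Ω v⟫_ℂ}
  zero_mem' := by
    refine ⟨(curl Ω).domain.zero_mem, fun v => ?_⟩
    have : curl Ω ⟨0, (curl Ω).domain.zero_mem⟩ = 0 := (curl Ω).map_zero
    rw [this, inner_zero_left, inner_zero_left]
  add_mem' := by
    rintro a b ⟨ha, ha'⟩ ⟨hb, hb'⟩
    refine ⟨(curl Ω).domain.add_mem ha hb, fun v => ?_⟩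
    have : curl Ω ⟨a + b, (curl Ω).domain.add_mem ha hb⟩ = curl Ω ⟨a, ha⟩ + curl Ω ⟨b, hb⟩ :=
      (curl Ω).map_add ⟨a, ha⟩ ⟨b, hb⟩
    rw [this, inner_add_left, inner_add_left, ha', hb']
  smul_mem' := by
    rintro c a ⟨ha, ha'⟩
    refine ⟨(curl Ω).domain.smul_mem c ha, fun v => ?_⟩
    have : curl Ω ⟨c • a, (curl Ω).domain.smul_mem c ha⟩ = c • curl Ω ⟨a, ha⟩ :=
      (curl Ω).map_smul c ⟨a, ha⟩
    rw [this, inner_smul_left, inner_smul_left, ha']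

theorem H0curl_le : H0curl Ω ≤ (curl Ω).domain := fun _ h => h.1

/-- The operator `curl₀`: the restriction of `curl` to `H₀(curl, Ω)`. -/
def curl0 : L2 Ω →ₗ.[ℂ] L2 Ω where
  domain := H0curl Ω
  toFun := (curl Ω).toFun.comp (Submodule.inclusion (H0curl_le Ω))

variable {Ω}

theorem curl0_apply (u : (curl0 Ω).domain) :
    curl0 Ω u = curl Ω ⟨u, H0curl_le Ω u.2⟩ := rfl

/-- `curl₀` is the adjoint of `curl`. -/
theorem curl0_eq_adjoint : curl0 Ω = (curl Ω).adjoint := by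
  refine le_antisymm ?_ ?_
  · refine LinearPMap.IsFormalAdjoint.le_adjoint curl_dense ?_
    refine LinearPMap.IsFormalAdjoint.symm fun u v => ?_
    obtain ⟨hu, h⟩ := u.2
    rw [curl0_apply]
    exact h v
  · have key : ∀ y : (curl Ω).adjoint.domain, IsWeakCurl Ω y ((curl Ω).adjoint y) := by
      intro y
      rw [isWeakCurl_iff]
      intro φ h
      have h1 := LinearPMap.adjoint_isFormalAdjoint curl_dense y ⟨h.toL2, h.mem_curl_domain⟩
      rw [curl_eq_of_isWeakCurl ⟨h.toL2, h.mem_curl_domain⟩ h.isWeakCurl] at h1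
      have h2 := congrArg (starRingEnd ℂ) h1
      rw [inner_conj_symm, inner_conj_symm] at h2
      exact h2.symm
    have hdom : ∀ y : (curl Ω).adjoint.domain, (y : L2 Ω) ∈ H0curl Ω := by
      intro y
      refine ⟨mem_curl_domain.2 ⟨_, key y⟩, fun v => ?_⟩
      rw [curl_eq_of_isWeakCurl ⟨(y : L2 Ω), mem_curl_domain.2 ⟨_, key y⟩⟩ (key y)]
      exact LinearPMap.adjoint_isFormalAdjoint curl_dense y v
    refine ⟨fun y hy => hdom ⟨y, hy⟩, fun y z hyz => ?_⟩
    rw [curl0_apply]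
    refine (curl_eq_of_isWeakCurl ⟨(z : L2 Ω), H0curl_le Ω z.2⟩ ?_).symm
    have hk := key y
    rw [hyz] at hk
    exact hk

/-! ### The operator `curl curl₀` on divergence-free fields -/

variable (Ω)

/-- The space `H(div 0, Ω)` as a closed subspace of `L²(Ω)³`. -/
def Hdiv0 : Submodule ℂ (L2 Ω) where
  carrier := {u | IsWeakDivFree Ω u}
  zero_mem' := by
    rw [Set.mem_ofPred_eq, isWeakDivFree_iff]
    intro φ h
    simp
  add_mem' := by
    intro p q hp hq
    rw [Set.mem_ofPred_eq, isWeakDivFree_iff] at *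
    intro φ h
    simp [inner_add_right, hp φ h, hq φ h]
  smul_mem' := by
    intro c p hp
    rw [Set.mem_ofPred_eq, isWeakDivFree_iff] at *
    intro φ h
    simp [inner_smul_right, hp φ h]

theorem curl_mem_Hdiv0 (u : (curl Ω).domain) : curl Ω u ∈ Hdiv0 Ω := by
  refine isWeakDivFree_iff.2 fun φ h => ?_
  rw [← isWeakCurl_iff.1 (curl_spec u) _ h.classicalGrad, inner_toL2]
  simp [h.curl_grad]

/-- The restriction of `curl curl₀` to `H(div 0, Ω)`, as an operator in the Hilbert space
`H(div 0, Ω)`, on the domain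
`{u ∈ H₀(curl, Ω) ∩ H(div 0, Ω) : curl u ∈ H(curl, Ω)}`. -/
def curlCurl0 : Hdiv0 Ω →ₗ.[ℂ] Hdiv0 Ω where
  domain :=
    { carrier := {u | ∃ hu : (u : L2 Ω) ∈ (curl0 Ω).domain,
        curl0 Ω ⟨u, hu⟩ ∈ (curl Ω).domain}
      zero_mem' := by
        refine ⟨(curl0 Ω).domain.zero_mem, ?_⟩
        have : curl0 Ω ⟨((0 : Hdiv0 Ω) : L2 Ω), (curl0 Ω).domain.zero_mem⟩ = 0 :=
          (curl0 Ω).map_zero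
        rw [this]
        exact (curl Ω).domain.zero_mem
      add_mem' := by
        rintro a b ⟨ha, ha'⟩ ⟨hb, hb'⟩
        refine ⟨(curl0 Ω).domain.add_mem ha hb, ?_⟩
        have : curl0 Ω ⟨((a + b : Hdiv0 Ω) : L2 Ω), (curl0 Ω).domain.add_mem ha hb⟩ =
            curl0 Ω ⟨a, ha⟩ + curl0 Ω ⟨b, hb⟩ := (curl0 Ω).map_add ⟨a, ha⟩ ⟨b, hb⟩
        rw [this]
        exact (curl Ω).domain.add_mem ha' hb'
      smul_mem' := by
        rintro c a ⟨ha, ha'⟩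
        refine ⟨(curl0 Ω).domain.smul_mem c ha, ?_⟩
        have : curl0 Ω ⟨((c • a : Hdiv0 Ω) : L2 Ω), (curl0 Ω).domain.smul_mem c ha⟩ =
            c • curl0 Ω ⟨a, ha⟩ := (curl0 Ω).map_smul c ⟨a, ha⟩
        rw [this]
        exact (curl Ω).domain.smul_mem c ha' }
  toFun :=
    { toFun := fun u => ⟨curl Ω ⟨curl0 Ω ⟨u, u.2.1⟩, u.2.2⟩, curl_mem_Hdiv0 Ω _⟩
      map_add' := by
        intro a b
        refine Subtype.ext ?_
        refine Eq.trans ?_ ((curl Ω).map_add ⟨curl0 Ω ⟨a, a.2.1⟩, a.2.2⟩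
          ⟨curl0 Ω ⟨b, b.2.1⟩, b.2.2⟩)
        refine congrArg (curl Ω) (Subtype.ext ?_)
        exact (curl0 Ω).map_add ⟨a, a.2.1⟩ ⟨b, b.2.1⟩
      map_smul' := by
        intro c a
        refine Subtype.ext ?_
        refine Eq.trans ?_ ((curl Ω).map_smul c ⟨curl0 Ω ⟨a, a.2.1⟩, a.2.2⟩)
        refine congrArg (curl Ω) (Subtype.ext ?_)
        exact (curl0 Ω).map_smul c ⟨a, a.2.1⟩ }

end Operators

/-! ### Spectra -/

section Spectra

/-- `T : dom T → F` is bijective and its inverse is bounded. -/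
def BoundedlyInvertible {E F : Type} [NormedAddCommGroup E] [NormedSpace ℂ E]
    [NormedAddCommGroup F] [NormedSpace ℂ F] (T : E →ₗ.[ℂ] F) : Prop :=
  Function.Bijective (fun x : T.domain => T x) ∧
    ∃ C : ℝ, ∀ x : T.domain, ‖(x : E)‖ ≤ C * ‖T x‖

/-- The spectrum of an operator pencil: the points where it is not boundedly invertible. -/
def pencilSpectrum {E F : Type} [NormedAddCommGroup E] [NormedSpace ℂ E]
    [NormedAddCommGroup F] [NormedSpace ℂ F] (P : ℂ → (E →ₗ.[ℂ] F)) : Set ℂ :=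
  {z | ¬ BoundedlyInvertible (P z)}

/-- The spectrum of an operator `A`, that is, of the pencil `A - z`. -/
def opSpectrum {E : Type} [NormedAddCommGroup E] [NormedSpace ℂ E] (A : E →ₗ.[ℂ] E) : Set ℂ :=
  pencilSpectrum fun z => (-(z • (LinearMap.id : E →ₗ[ℂ] E))) +ᵥ A

/-- `λ_min^Ω`, the bottom of the spectrum of `curl curl₀` in `H(div 0, Ω)`. -/
def lambdaMin (Ω : TopologicalSpace.Opens R3) : ℝ :=
  sInf {t : ℝ | (t : ℂ) ∈ opSpectrum (curlCurl0 Ω)}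

end Spectra

/-! ### Coefficients and the Maxwell pencil -/

/-- A symmetric matrix-valued function in `L^∞(Ω, ℝ^{3×3})`. -/
structure Coefficient (Ω : TopologicalSpace.Opens R3) where
  /-- the matrix at a point -/
  val : R3 → Matrix (Fin 3) (Fin 3) ℝ
  aemeasurable : ∀ i j, AEMeasurable (fun x => val x i j) (vol Ω)
  bounded : ∃ C : ℝ, ∀ᵐ x ∂(vol Ω), ∀ i j, |val x i j| ≤ C
  symm : ∀ᵐ x ∂(vol Ω), (val x).IsSymm

namespace Coefficient

variable {Ω : TopologicalSpace.Opens R3} (M : Coefficient Ω)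

/-- `a ≤ η · M(x) η ≤ b` for almost all `x ∈ Ω` and all unit vectors `η ∈ ℝ³`. -/
def BoundedBy (a b : ℝ) : Prop :=
  ∀ᵐ x ∂(vol Ω), ∀ η : Fin 3 → ℝ, η ⬝ᵥ η = 1 →
    a ≤ η ⬝ᵥ (M.val x).mulVec η ∧ η ⬝ᵥ (M.val x).mulVec η ≤ b

/-- The real matrix `M(x)` applied to a complex vector. -/
def act (x : R3) (z : C3) : C3 :=
  WithLp.toLp 2 (((M.val x).map (fun r : ℝ => (r : ℂ))).mulVec z.ofLp)

theorem act_eq (x : R3) (z : C3) :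
    M.act x z = ∑ i, ∑ j, ((M.val x i j : ℝ) : ℂ) • z j • (EuclideanSpace.single i (1 : ℂ) : C3) := by
  ext k
  fin_cases k <;> simp [act, Matrix.mulVec, dotProduct, Fin.sum_univ_three]

theorem act_add (x : R3) (z w : C3) : M.act x (z + w) = M.act x z + M.act x w := by
  simp [act, Matrix.mulVec_add]

theorem act_smul (x : R3) (c : ℂ) (z : C3) : M.act x (c • z) = c • M.act x z := by
  simp [act, Matrix.mulVec_smul]

theorem memLp_act (u : L2 Ω) : MemLp (fun x => M.act x (u x)) 2 (vol Ω) := by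
  obtain ⟨C, hC⟩ := M.bounded
  simp only [act_eq]
  refine memLp_finsetSum _ fun i _ => memLp_finsetSum _ fun j _ => ?_
  have hu := Lp.memLp u
  have huj : MemLp (fun x => (u x) j) 2 (vol Ω) :=
    (EuclideanSpace.proj j : C3 →L[ℂ] ℂ).comp_memLp' hu
  refine hu.of_le_mul (c := C) ?_ ?_
  · refine AEStronglyMeasurable.smul (𝕜 := ℂ) ?_
      (huj.1.smul_const (EuclideanSpace.single i (1 : ℂ) : C3))
    exact (Complex.measurable_ofReal.comp_aemeasurable (M.aemeasurable i j)).aestronglyMeasurable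
  · filter_upwards [hC] with x hx
    rw [norm_smul, norm_smul]
    have h1 : ‖((M.val x i j : ℝ) : ℂ)‖ ≤ C := by simpa using hx i j
    have h2 : ‖(u x) j‖ ≤ ‖u x‖ := PiLp.norm_apply_le (u x) j
    have h3 : ‖(EuclideanSpace.single i (1 : ℂ) : C3)‖ = 1 := by simp
    rw [h3, mul_one]
    exact mul_le_mul h1 h2 (norm_nonneg _) ((norm_nonneg _).trans h1)

/-- The operator of multiplication by `M` in `L²(Ω)³`. -/
def mulOp : L2 Ω →ₗ[ℂ] L2 Ω where
  toFun u := (M.memLp_act u).toLp _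
  map_add' u v := by
    rw [← MemLp.toLp_add]
    refine MemLp.toLp_congr _ _ ?_
    filter_upwards [Lp.coeFn_add u v] with x hx
    rw [Pi.add_apply, hx, Pi.add_apply, act_add]
  map_smul' c u := by
    rw [RingHom.id_apply, ← MemLp.toLp_const_smul]
    refine MemLp.toLp_congr _ _ ?_
    filter_upwards [Lp.coeFn_smul c u] with x hx
    rw [Pi.smul_apply, hx, Pi.smul_apply, act_smul]

end Coefficient

section Aux

variable {X : Type*} [AddCommGroup X] [Module ℂ X]

theorem pencil_aux_add (i j k : ℂ) {a b c a' b' c' s t u : X} (hs : s = a + a')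
    (ht : t = b + b') (hu : u = c + c') :
    i • s + j • t - k • u = (i • a + j • b - k • c) + (i • a' + j • b' - k • c') := by
  subst hs ht hu
  module

theorem pencil_aux_add' (i k : ℂ) {a c a' c' s u : X} (hs : s = a + a') (hu : u = c + c') :
    i • s - k • u = (i • a - k • c) + (i • a' - k • c') := by
  subst hs hu
  module

theorem pencil_aux_smul (r i j k : ℂ) {a b c s t u : X} (hs : s = r • a) (ht : t = r • b)
    (hu : u = r • c) : i • s + j • t - k • u = r • (i • a + j • b - k • c) := by
  subst hs ht hu
  module

theorem pencil_aux_smul' (r i k : ℂ) {a c s u : X} (hs : s = r • a) (hu : u = r • c) :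
    i • s - k • u = r • (i • a - k • c) := by
  subst hs hu
  module

end Aux

/-- The Maxwell pencil
`V(ω)(E, H) = (-iσE + i curl H - ω ε E, -i curl₀ E - ω μ H)` in `L²(Ω)³ ⊕ L²(Ω)³`
on the domain `H₀(curl, Ω) ⊕ H(curl, Ω)`. -/
def pencil {Ω : TopologicalSpace.Opens R3} (ε μ σ : Coefficient Ω) (ω : ℂ) :
    L2Pair Ω →ₗ.[ℂ] L2Pair Ω where
  domain :=
    { carrier := {p | p.fst ∈ (curl0 Ω).domain ∧ p.snd ∈ (curl Ω).domain}
      zero_mem' := ⟨(curl0 Ω).domain.zero_mem, (curl Ω).domain.zero_mem⟩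
      add_mem' := fun ha hb =>
        ⟨(curl0 Ω).domain.add_mem ha.1 hb.1, (curl Ω).domain.add_mem ha.2 hb.2⟩
      smul_mem' := fun c _ ha =>
        ⟨(curl0 Ω).domain.smul_mem c ha.1, (curl Ω).domain.smul_mem c ha.2⟩ }
  toFun :=
    { toFun := fun p => WithLp.toLp 2
        (-Complex.I • σ.mulOp p.1.fst + Complex.I • curl Ω ⟨p.1.snd, p.2.2⟩
            - ω • ε.mulOp p.1.fst,
          -Complex.I • curl0 Ω ⟨p.1.fst, p.2.1⟩ - ω • μ.mulOp p.1.snd)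
      map_add' := by
        intro a b
        refine congrArg (WithLp.toLp 2) (Prod.ext ?_ ?_)
        · exact pencil_aux_add _ _ _ (map_add σ.mulOp a.1.fst b.1.fst)
            ((curl Ω).map_add ⟨a.1.snd, a.2.2⟩ ⟨b.1.snd, b.2.2⟩)
            (map_add ε.mulOp a.1.fst b.1.fst)
        · exact pencil_aux_add' _ _ ((curl0 Ω).map_add ⟨a.1.fst, a.2.1⟩ ⟨b.1.fst, b.2.1⟩)
            (map_add μ.mulOp a.1.snd b.1.snd)
      map_smul' := by
        intro c a
        refine congrArg (WithLp.toLp 2) (Prod.ext ?_ ?_)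
        · exact pencil_aux_smul c _ _ _ (map_smul σ.mulOp c a.1.fst)
            ((curl Ω).map_smul c ⟨a.1.snd, a.2.2⟩) (map_smul ε.mulOp c a.1.fst)
        · exact pencil_aux_smul' c _ _ ((curl0 Ω).map_smul c ⟨a.1.fst, a.2.1⟩)
            (map_smul μ.mulOp c a.1.snd) }

end Maxwell

end

/-! For `ω ≠ 0` the second row of `V(ω)(E, H) = (f, g)` gives `H = -ω⁻¹ μ⁻¹ (i curl₀ E + g)`.
Inserting this in the first row leaves the Schur complement `curl μ⁻¹ curl₀ - ω² ε - iωσ`, read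
weakly on the domain `V` of `curl₀` with the graph norm. If this bounded operator on `V` is
invertible, so is `V(ω)` (`boundedlyInvertible_pencil`). Its adjoint is the Schur complement at
`-conj ω` and the enclosure is invariant under `ω ↦ -conj ω`, so a lower bound `c ‖u‖ ≤ ‖T(ω) u‖` at
every `ω` outside the enclosure suffices (`isUnit_of_bounded_below`).

For `ω = iτ` the form is `⟨curl₀ u, μ⁻¹ curl₀ u⟩ + τ² ⟨u, εu⟩ + τ ⟨u, σu⟩`, which is coercive when
`τ > 0` or `τ < -σmax / εmin`. For `Re ω ≠ 0` suppose that there are unit vectors `vₙ` with `T(ω) vₙ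
→ 0`, and put `e = ⟨v, εv⟩`, `s = ⟨v, σv⟩`, `a = ⟨curl₀ v, μ⁻¹ curl₀ v⟩`. Testing with `vₙ` gives,
along a subsequence, `e → x > 0`, `s → -2 Im ω x`, `a → |ω|² x`; comparing `σ` with `ε` bounds `Im
ω`. Testing with the part `g` of `vₙ` orthogonal to the divergence-free fields, which `curl₀`
annihilates, shows that `⟨v, Cv⟩` and `⟨v - g, Cv⟩` have the same limit, where `C = ω² ε + iωσ`. As
`v - g` is divergence-free, `λmin ‖v - g‖² ≤ ‖curl₀ v‖² ≤ μmax a`. With Cauchy–Schwarz and the bound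
on `‖Cv‖²` in `norm_sq_coefficient_le` this yields the second inequality of the enclosure
(`enclosure_of_limits`).

The number `λmin` is treated by forms too: it is the infimum of the Rayleigh quotients of `curl
curl₀` on divergence-free fields (`isLeast_spectrum`). The gaps and the separation are elementary
consequences of the enclosure. -/

namespace Maxwell

/-! ### Bounded symmetric operators and invertibility criteria. -/

section SymmetricOperators

variable {H : Type} [NormedAddCommGroup H] [InnerProductSpace ℂ H]

/-- Cauchy–Schwarz inequality for the form of a non-negative symmetric operator. -/
theorem cauchy_schwarz_of_nonneg (M : H →ₗ[ℂ] H) (hM : M.IsSymmetric)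
    (h0 : ∀ u, 0 ≤ (⟪u, M u⟫_ℂ).re) (u v : H) :
    ‖⟪u, M v⟫_ℂ‖ ^ 2 ≤ (⟪u, M u⟫_ℂ).re * (⟪v, M v⟫_ℂ).re := by
  let c : PreInnerProductSpace.Core ℂ H :=
    { inner := fun x y => ⟪x, M y⟫_ℂ
      conj_inner_symm := fun x y => by rw [inner_conj_symm, hM]
      re_inner_nonneg := h0
      add_left := fun x y z => inner_add_left _ _ _
      smul_left := fun x y r => inner_smul_left _ _ _ }
  have h : ‖⟪u, M v⟫_ℂ‖ * ‖⟪v, M u⟫_ℂ‖ ≤ (⟪u, M u⟫_ℂ).re * (⟪v, M v⟫_ℂ).re :=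
    @InnerProductSpace.Core.inner_mul_inner_self_le ℂ H _ _ _ c u v
  rwa [← hM v u, ← inner_conj_symm (M v) u, RCLike.norm_conj, ← sq] at h

theorem inner_eq_re_of_symmetric {M : H →ₗ[ℂ] H} (hM : M.IsSymmetric) (u : H) :
    ⟪u, M u⟫_ℂ = (((⟪u, M u⟫_ℂ).re : ℝ) : ℂ) := by
  refine (Complex.conj_eq_iff_re.1 ?_).symm
  rw [inner_conj_symm, hM]

/-- The operator `M` is symmetric with `a ≤ M ≤ b`. -/
structure SymmBounds (M : H →L[ℂ] H) (a b : ℝ) : Prop where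
  symm : (M : H →ₗ[ℂ] H).IsSymmetric
  lower : ∀ u, a * ‖u‖ ^ 2 ≤ (⟪u, M u⟫_ℂ).re
  upper : ∀ u, (⟪u, M u⟫_ℂ).re ≤ b * ‖u‖ ^ 2

namespace SymmBounds

variable {M : H →L[ℂ] H} {a b : ℝ}

theorem inner_eq (h : SymmBounds M a b) (u : H) :
    ⟪u, M u⟫_ℂ = (((⟪u, M u⟫_ℂ).re : ℝ) : ℂ) :=
  inner_eq_re_of_symmetric h.symm u

theorem inner_nonneg (h : SymmBounds M a b) (ha : 0 ≤ a) (u : H) : 0 ≤ (⟪u, M u⟫_ℂ).re :=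
  (by positivity : (0 : ℝ) ≤ a * ‖u‖ ^ 2).trans (h.lower u)

theorem cauchy_schwarz (h : SymmBounds M a b) (ha : 0 ≤ a) (u v : H) :
    ‖⟪u, M v⟫_ℂ‖ ^ 2 ≤ (⟪u, M u⟫_ℂ).re * (⟪v, M v⟫_ℂ).re :=
  cauchy_schwarz_of_nonneg _ h.symm (h.inner_nonneg ha) u v

/-- Cauchy–Schwarz for the form of `M`, applied to `M u` and `u`, gives `‖M u‖⁴ ≤ ⟨M u, M (M u)⟩ ⟨u,
M u⟩`; the upper bound on the first factor lets `‖M u‖²` cancel. -/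
theorem norm_sq_le (h : SymmBounds M a b) (ha : 0 ≤ a) (u : H) :
    ‖M u‖ ^ 2 ≤ b * (⟪u, M u⟫_ℂ).re := by
  have h1 := h.cauchy_schwarz ha (M u) u
  have h2 : ‖⟪M u, M u⟫_ℂ‖ = ‖M u‖ ^ 2 := by
    rw [inner_self_eq_norm_sq_to_K]; simp
  rw [h2] at h1
  have h3 := mul_le_mul_of_nonneg_right (h.upper (M u)) (h.inner_nonneg ha u)
  rcases (norm_nonneg (M u)).eq_or_lt with h0 | h0
  · have : M u = 0 := norm_eq_zero.1 h0.symm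
    simp [this]
  · have h4 : 0 < ‖M u‖ ^ 2 := by positivity
    refine le_of_mul_le_mul_right ?_ h4
    nlinarith

/-- A coercive symmetric operator has an inverse, whose form is bounded below. -/
theorem exists_inverse [CompleteSpace H] (h : SymmBounds M a b) (ha : 0 < a) :
    ∃ N : H →L[ℂ] H, (∀ u, M (N u) = u) ∧ (∀ u, N (M u) = u) ∧
      (N : H →ₗ[ℂ] H).IsSymmetric ∧ ∀ u, ‖u‖ ^ 2 ≤ b * (⟪u, N u⟫_ℂ).re := by
  have hu : IsUnit M := by
    refine ContinuousLinearMap.isUnit_of_forall_le_norm_inner_map M (c := ⟨a, ha.le⟩) ha fun x => ?_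
    have h1 := (h.lower x).trans (Complex.re_le_norm _)
    rw [← inner_conj_symm, RCLike.norm_conj, mul_comm]
    exact h1
  obtain ⟨U, rfl⟩ := hu
  have h1 : ∀ u, (U : H →L[ℂ] H) ((↑U⁻¹ : H →L[ℂ] H) u) = u := fun u =>
    congrArg (fun T : H →L[ℂ] H => T u) U.mul_inv
  have h2 : ∀ u, (↑U⁻¹ : H →L[ℂ] H) ((U : H →L[ℂ] H) u) = u := fun u =>
    congrArg (fun T : H →L[ℂ] H => T u) U.inv_mul
  have h3 : ((↑U⁻¹ : H →L[ℂ] H) : H →ₗ[ℂ] H).IsSymmetric := by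
    intro x y
    have := h.symm ((↑U⁻¹ : H →L[ℂ] H) x) ((↑U⁻¹ : H →L[ℂ] H) y)
    simp only [ContinuousLinearMap.coe_coe, h1] at this ⊢
    exact this.symm
  refine ⟨↑U⁻¹, h1, h2, h3, fun u => ?_⟩
  -- The estimate `‖M w‖² ≤ b ⟨w, M w⟩` at `w = M⁻¹ u`.
  have := h.norm_sq_le ha.le ((↑U⁻¹ : H →L[ℂ] H) u)
  rw [h1, ← inner_conj_symm, Complex.conj_re] at this
  exact this

end SymmBounds

/-- A bounded operator that is bounded below together with its adjoint is invertible. -/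
theorem isUnit_of_bounded_below [CompleteSpace H] (B B' : H →L[ℂ] H)
    (hadj : ∀ u v, ⟪B' u, v⟫_ℂ = ⟪u, B v⟫_ℂ)
    (hB : ∃ c > 0, ∀ u, c * ‖u‖ ≤ ‖B u‖) (hB' : ∃ c > 0, ∀ u, c * ‖u‖ ≤ ‖B' u‖) : IsUnit B := by
  obtain ⟨c, hc, h⟩ := hB
  obtain ⟨c', hc', h'⟩ := hB'
  have hanti : AntilipschitzWith (⟨c⁻¹, by positivity⟩ : NNReal) B := by
    refine B.antilipschitz_of_bound fun x => ?_
    have : ‖x‖ = c⁻¹ * (c * ‖x‖) := by field_simp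
    rw [this]
    exact mul_le_mul_of_nonneg_left (h x) (by positivity)
  rw [ContinuousLinearMap.isUnit_iff_bijective]
  refine ⟨hanti.injective, ?_⟩
  have hcl : IsClosed (B.range : Set H) := hanti.isClosed_range B.uniformContinuous
  have htop : B.range = ⊤ := by
    have := hcl.completeSpace_coe
    rw [← Submodule.orthogonal_eq_bot_iff, Submodule.eq_bot_iff]
    intro w hw
    -- The range of `B` is closed by the lower bound; its orthogonal complement is the kernel of the
    -- adjoint `B'`, which is trivial.
    have hz : B' w = 0 := by
      refine ext_inner_right ℂ fun v => ?_
      rw [hadj, inner_zero_left]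
      exact (Submodule.mem_orthogonal' _ _).1 hw _ ⟨v, rfl⟩
    have := h' w
    rw [hz, norm_zero] at this
    exact norm_eq_zero.1 (le_antisymm (by nlinarith [norm_nonneg w]) (norm_nonneg w))
  exact LinearMap.range_eq_top.1 htop

end SymmetricOperators

/-! ### Lower bounds for an abstract Schur complement. -/

section SchurComplement

open ContinuousLinearMap Filter Topology

variable {V H : Type} [NormedAddCommGroup V] [InnerProductSpace ℂ V]
  [NormedAddCommGroup H] [InnerProductSpace ℂ H]

/-- An operator that is not bounded below has an approximate null sequence. -/
theorem exists_seq_of_not_bounded_below {B : V →L[ℂ] V}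
    (h : ¬ ∃ c > 0, ∀ u, c * ‖u‖ ≤ ‖B u‖) :
    ∃ v : ℕ → V, (∀ n, ‖v n‖ = 1) ∧ Tendsto (fun n => ‖B (v n)‖) atTop (𝓝 0) := by
  push Not at h
  choose u hu using fun n : ℕ => h (1 / (n + 1)) (by positivity)
  have hpos : ∀ n, 0 < ‖u n‖ := by
    intro n
    rcases (norm_nonneg (u n)).eq_or_lt with h0 | h0
    · have := hu n
      rw [← h0, mul_zero] at this
      exact absurd this (norm_nonneg _).not_gt
    · exact h0
  refine ⟨fun n => ((‖u n‖⁻¹ : ℝ) : ℂ) • u n, fun n => ?_, ?_⟩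
  · rw [norm_smul]
    simp [(hpos n).ne']
  · refine squeeze_zero (fun n => norm_nonneg _) (fun n => ?_)
      (tendsto_one_div_add_atTop_nhds_zero_nat (𝕜 := ℝ))
    rw [map_smul, norm_smul]
    simp only [Complex.norm_real, norm_inv, norm_norm]
    rw [inv_mul_le_iff₀ (hpos n), mul_comm]
    exact (hu n).le

/-- The quotient `σmax / εmin` of the enclosure originates here; the upper bound of `S` enters the
argument only through this comparison of forms. -/
theorem inner_le_div_mul_inner {E S : H →L[ℂ] H} {εmin εmax σmin σmax : ℝ}
    (hε : 0 < εmin) (hE : SymmBounds E εmin εmax) (hσm : 0 ≤ σmax)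
    (hS : SymmBounds S σmin σmax) (w : H) :
    (⟪w, S w⟫_ℂ).re ≤ σmax / εmin * (⟪w, E w⟫_ℂ).re := by
  refine (hS.upper w).trans ?_
  rw [div_mul_eq_mul_div, le_div_iff₀ hε]
  have := mul_le_mul_of_nonneg_left (hE.lower w) hσm
  linarith

/-- The numerical relations that hold in the limit along an approximate null sequence. -/
theorem enclosure_of_limits {ω : ℂ} {εmin εmax μmax smax smin l : ℝ} (hre : ω.re ≠ 0)
    (hμ : 0 < μmax) (hεm : 0 < εmax) (hsm : 0 ≤ smax)
    (e s a : ℕ → ℝ) (z : ℕ → ℂ)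
    (h1 : Tendsto (fun n => (a n : ℂ) - (ω ^ 2 * (e n : ℂ) + Complex.I * ω * (s n : ℂ)))
      atTop (𝓝 0))
    (hz : Tendsto z atTop (𝓝 0)) (he0 : ∀ n, 0 ≤ e n) (heb : ∃ M, ∀ n, e n ≤ M)
    (hs1 : ∀ n, smin * e n ≤ s n) (hs2 : ∀ n, s n ≤ smax * e n)
    (hone : ∀ n, 1 ≤ εmin⁻¹ * e n + μmax * a n)
    (hmain : ∀ n, l * ‖ω ^ 2 * (e n : ℂ) + Complex.I * ω * (s n : ℂ) + z n‖ ^ 2 ≤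
      μmax * a n * (εmax * (‖ω‖ ^ 2 * (‖ω‖ ^ 2 * e n + (smax + 2 * ω.im) * s n)))) :
    ω.im ∈ Set.Icc (-(1 / 2 * smax)) (-(1 / 2 * smin)) ∧
      l / (εmax * μmax) ≤ ω.re ^ 2 - 3 * ω.im ^ 2 + 2 * smax * |ω.im| := by
  obtain ⟨M, hM⟩ := heb
  -- Only `e` needs compactness: the imaginary and real parts of `h1` then determine the limits of
  -- `s` and `a`. The former requires division by `Re ω`.
  obtain ⟨x, -, φ, hφ, hx⟩ := isCompact_Icc.tendsto_subseq fun n => (⟨he0 n, hM n⟩ : e n ∈ Set.Icc 0 M)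
  have hφt := hφ.tendsto_atTop
  have h1' := h1.comp hφt
  have hx' : Tendsto (fun n => e (φ n)) atTop (𝓝 x) := hx
  have him := (Complex.continuous_im.tendsto _).comp h1'
  have hres := (Complex.continuous_re.tendsto _).comp h1'
  have hs : Tendsto (fun n => s (φ n)) atTop (𝓝 (-2 * ω.im * x)) := by
    have h2 := (him.const_mul (-ω.re⁻¹)).sub (hx'.const_mul (2 * ω.im))
    refine (h2.congr fun n => ?_).trans (le_of_eq ?_)
    · simp [pow_two]
      field_simp
      ring
    · simp
  have ha : Tendsto (fun n => a (φ n)) atTop (𝓝 (‖ω‖ ^ 2 * x)) := by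
    have h2 := (hres.add (hx'.const_mul (ω.re ^ 2 - ω.im ^ 2))).sub (hs.const_mul ω.im)
    refine (h2.congr fun n => ?_).trans (le_of_eq ?_)
    · simp [pow_two]
      ring
    · rw [← Complex.normSq_eq_norm_sq, Complex.normSq_apply]
      congr 1
      simp
      ring
  -- If `x = 0`, then `e` and `a` both tend to zero, contrary to the normalisation `hone`.
  have hxpos : 0 < x := by
    have h2 : (1 : ℝ) ≤ εmin⁻¹ * x + μmax * (‖ω‖ ^ 2 * x) :=
      ge_of_tendsto' ((hx'.const_mul εmin⁻¹).add (ha.const_mul μmax)) fun n => hone (φ n)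
    by_contra hneg
    have h3 : x = 0 := le_antisymm (not_lt.1 hneg) (ge_of_tendsto' hx' fun n => he0 _)
    rw [h3] at h2
    norm_num at h2
  have hωpos : 0 < ‖ω‖ ^ 2 := by
    have : ω ≠ 0 := fun h => hre (by simp [h])
    positivity
  have hup : -2 * ω.im * x ≤ smax * x :=
    le_of_tendsto_of_tendsto' hs (hx'.const_mul smax) fun n => hs2 _
  have hlo : smin * x ≤ -2 * ω.im * x :=
    le_of_tendsto_of_tendsto' (hx'.const_mul smin) hs fun n => hs1 _
  have hup' := le_of_mul_le_mul_right hup hxpos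
  have hlo' := le_of_mul_le_mul_right hlo hxpos
  refine ⟨⟨by linarith, by linarith⟩, ?_⟩
  have hC : Tendsto (fun n => ω ^ 2 * (e (φ n) : ℂ) + Complex.I * ω * (s (φ n) : ℂ) + z (φ n))
      atTop (𝓝 ((‖ω‖ ^ 2 * x : ℝ) : ℂ)) := by
    have h2 : Tendsto (fun n => (a (φ n) : ℂ)) atTop (𝓝 ((‖ω‖ ^ 2 * x : ℝ) : ℂ)) :=
      (Complex.continuous_ofReal.tendsto _).comp ha
    have h3 := (h2.sub h1').add (hz.comp hφt)
    refine (h3.congr fun n => ?_).trans (le_of_eq ?_)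
    · simp
    · simp
  have hlim : l * ‖((‖ω‖ ^ 2 * x : ℝ) : ℂ)‖ ^ 2 ≤ μmax * (‖ω‖ ^ 2 * x) *
      (εmax * (‖ω‖ ^ 2 * (‖ω‖ ^ 2 * x + (smax + 2 * ω.im) * (-2 * ω.im * x)))) :=
    le_of_tendsto_of_tendsto' ((hC.norm.pow 2).const_mul l)
      ((ha.const_mul μmax).mul (((((hx'.const_mul (‖ω‖ ^ 2)).add
        (hs.const_mul (smax + 2 * ω.im))).const_mul (‖ω‖ ^ 2))).const_mul εmax)) fun n => hmain _
  rw [Complex.norm_real, Real.norm_eq_abs, sq_abs] at hlim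
  have hsq : ‖ω‖ ^ 2 = ω.re ^ 2 + ω.im ^ 2 := by
    rw [← Complex.normSq_eq_norm_sq, Complex.normSq_apply]
    ring
  -- Both sides of `hlim` carry the factor `(‖ω‖² x)²`. With `‖ω‖² = Re² + Im²` the bracket equals
  -- `Re² - 3 Im² - 2 smax Im`.
  have hkey : l ≤ μmax * εmax * (‖ω‖ ^ 2 + (smax + 2 * ω.im) * (-2 * ω.im)) := by
    have hp : 0 < (‖ω‖ ^ 2 * x) ^ 2 := by positivity
    refine le_of_mul_le_mul_right (hlim.trans (le_of_eq ?_)) hp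
    ring
  rw [div_le_iff₀' (by positivity)]
  rw [hsq] at hkey
  have h4 : -2 * ω.im * smax ≤ 2 * smax * |ω.im| := by
    nlinarith [neg_abs_le ω.im]
  nlinarith [mul_pos hεm hμ]

variable [CompleteSpace V] [CompleteSpace H]

/-- The operator in the form domain of the Schur complement
`curl μ⁻¹ curl₀ - ω² ε - iωσ` of the Maxwell pencil. -/
noncomputable def schurOp (ι A : V →L[ℂ] H) (N E S : H →L[ℂ] H) (ω : ℂ) : V →L[ℂ] V :=
  adjoint A ∘L N ∘L A - adjoint ι ∘L (ω ^ 2 • E + (Complex.I * ω) • S) ∘L ι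

theorem inner_schurOp (ι A : V →L[ℂ] H) (N E S : H →L[ℂ] H) (ω : ℂ) (u v : V) :
    ⟪u, schurOp ι A N E S ω v⟫_ℂ =
      ⟪A u, N (A v)⟫_ℂ - ⟪ι u, ω ^ 2 • E (ι v) + (Complex.I * ω) • S (ι v)⟫_ℂ := by
  simp [schurOp, adjoint_inner_right]

/-- The substitution `ω ↦ -conj ω` conjugates both scalars `ω²` and `iω`, while the operators are
symmetric. -/
theorem schurOp_adjoint (ι A : V →L[ℂ] H) {N E S : H →L[ℂ] H}
    (hN : (N : H →ₗ[ℂ] H).IsSymmetric) (hE : (E : H →ₗ[ℂ] H).IsSymmetric)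
    (hS : (S : H →ₗ[ℂ] H).IsSymmetric) (ω : ℂ) (u v : V) :
    ⟪schurOp ι A N E S (-(starRingEnd ℂ) ω) u, v⟫_ℂ = ⟪u, schurOp ι A N E S ω v⟫_ℂ := by
  have hN' : ∀ x y, ⟪N x, y⟫_ℂ = ⟪x, N y⟫_ℂ := hN
  have hE' : ∀ x y, ⟪E x, y⟫_ℂ = ⟪x, E y⟫_ℂ := hE
  have hS' : ∀ x y, ⟪S x, y⟫_ℂ = ⟪x, S y⟫_ℂ := hS
  rw [inner_schurOp, ← inner_conj_symm, inner_schurOp]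
  simp only [map_sub, inner_conj_symm, inner_add_right, inner_smul_right, map_add, map_mul,
    hN', hE', hS', map_pow, map_neg, Complex.conj_I, Complex.conj_conj]
  ring

/-- The Schur complement is bounded below for imaginary `ω` outside the enclosure. -/
theorem le_norm_schurOp_of_re_eq_zero {ι A : V →L[ℂ] H} {N E S : H →L[ℂ] H}
    {εmin εmax μmax σmin σmax : ℝ}
    (hVn : ∀ v, ‖v‖ ^ 2 = ‖ι v‖ ^ 2 + ‖A v‖ ^ 2)
    (hN : ∀ w, ‖w‖ ^ 2 ≤ μmax * (⟪w, N w⟫_ℂ).re)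
    (hμ : 0 < μmax) (hε : 0 < εmin) (hE : SymmBounds E εmin εmax)
    (hσ : 0 ≤ σmin) (hσm : 0 ≤ σmax) (hS : SymmBounds S σmin σmax)
    {ω : ℂ} (hre : ω.re = 0) (him : 0 < ω.im ∨ ω.im < -(σmax / εmin)) :
    ∃ c > 0, ∀ u, c * ‖u‖ ≤ ‖schurOp ι A N E S ω u‖ := by
  obtain ⟨κ, hκ, hle⟩ : ∃ κ > 0, ∀ w : H,
      κ * (⟪w, E w⟫_ℂ).re ≤ ω.im ^ 2 * (⟪w, E w⟫_ℂ).re + ω.im * (⟪w, S w⟫_ℂ).re := by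
    rcases him with h | h
    · refine ⟨ω.im ^ 2, by positivity, fun w => ?_⟩
      have := mul_nonneg h.le (hS.inner_nonneg hσ w)
      linarith
    -- With `τ = Im ω < 0` and `σ ≤ (σmax / εmin) ε`, the form of `τ² ε + τσ` is at least `-τ (-τ -
    -- σmax / εmin)` times that of `ε`.
    · have h1 : ω.im < 0 := by
        refine h.trans_le (neg_nonpos.2 (div_nonneg hσm hε.le))
      refine ⟨-ω.im * (-ω.im - σmax / εmin), mul_pos (by linarith) (by linarith), fun w => ?_⟩
      have h2 := inner_le_div_mul_inner hε hE hσm hS w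
      nlinarith
  have hform : ∀ v, (⟪v, schurOp ι A N E S ω v⟫_ℂ).re = (⟪A v, N (A v)⟫_ℂ).re
      + (ω.im ^ 2 * (⟪ι v, E (ι v)⟫_ℂ).re + ω.im * (⟪ι v, S (ι v)⟫_ℂ).re) := by
    intro v
    rw [inner_schurOp, inner_add_right, inner_smul_right, inner_smul_right, hE.inner_eq,
      hS.inner_eq]
    simp [hre, pow_two]
    ring
  refine ⟨min μmax⁻¹ (κ * εmin), lt_min (by positivity) (by positivity), fun u => ?_⟩
  have h1 : ‖A u‖ ^ 2 * μmax⁻¹ ≤ (⟪A u, N (A u)⟫_ℂ).re := by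
    rw [← div_eq_mul_inv, div_le_iff₀' hμ]
    exact hN _
  have h2 := mul_le_mul_of_nonneg_left (hE.lower (ι u)) hκ.le
  have h3 : min μmax⁻¹ (κ * εmin) * ‖u‖ ^ 2 ≤ (⟪u, schurOp ι A N E S ω u⟫_ℂ).re := by
    rw [hform, hVn]
    have h4 := mul_le_mul_of_nonneg_right (min_le_left μmax⁻¹ (κ * εmin)) (sq_nonneg ‖A u‖)
    have h5 := mul_le_mul_of_nonneg_right (min_le_right μmax⁻¹ (κ * εmin)) (sq_nonneg ‖ι u‖)
    linarith [hle (ι u)]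
  have h6 := (h3.trans (Complex.re_le_norm _)).trans (norm_inner_le_norm _ _)
  rcases (norm_nonneg u).eq_or_lt with h0 | h0
  · rw [← h0, mul_zero]
    exact norm_nonneg _
  · refine le_of_mul_le_mul_left ?_ h0
    linarith

/-- `|(ω² ε + iωσ) u|²` in terms of the forms of `ε` and `σ`. -/
theorem norm_sq_coefficient_le {E S : H →L[ℂ] H} {εmin εmax σmin σmax : ℝ}
    (hε : 0 < εmin) (hE : SymmBounds E εmin εmax) (hσ : 0 ≤ σmin) (hσm : 0 ≤ σmax)
    (hS : SymmBounds S σmin σmax) (ω : ℂ) (w : H) :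
    ‖ω ^ 2 • E w + (Complex.I * ω) • S w‖ ^ 2 ≤
      εmax * (‖ω‖ ^ 2 * (‖ω‖ ^ 2 * (⟪w, E w⟫_ℂ).re
        + (σmax / εmin + 2 * ω.im) * (⟪w, S w⟫_ℂ).re)) := by
  obtain ⟨K, hK, -, -, -⟩ := hE.exists_inverse hε
  have hEs : ∀ x y, ⟪E x, y⟫_ℂ = ⟪x, E y⟫_ℂ := hE.symm
  have hSs : ∀ x y, ⟪S x, y⟫_ℂ = ⟪x, S y⟫_ℂ := hS.symm
  have hεm : 0 ≤ εmax * (⟪w, E w⟫_ℂ).re := (sq_nonneg _).trans (hE.norm_sq_le hε.le w)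
  -- With `t = ε⁻¹ σ w` the vector to be estimated is `ε y` for `y = ω (ωw + it)`, and `‖ε y‖² ≤
  -- εmax ⟨y, εy⟩`. The cross terms of `⟨y, εy⟩` reduce to `⟨w, σw⟩`.
  set t := K (S w) with ht
  have hEt : E t = S w := hK _
  have hy : ω ^ 2 • E w + (Complex.I * ω) • S w = E (ω • (ω • w + Complex.I • t)) := by
    rw [← hEt]
    simp only [map_add, map_smul]
    module
  have hform : (⟪ω • (ω • w + Complex.I • t), E (ω • (ω • w + Complex.I • t))⟫_ℂ).re =
      ‖ω‖ ^ 2 * (‖ω‖ ^ 2 * (⟪w, E w⟫_ℂ).re + 2 * ω.im * (⟪w, S w⟫_ℂ).re + (⟪t, E t⟫_ℂ).re) := by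
    have h1 : ⟪t, E w⟫_ℂ = ⟪w, S w⟫_ℂ := by rw [← hEs, hEt, hSs]
    have h2 : ⟪w, E t⟫_ℂ = ⟪w, S w⟫_ℂ := by rw [hEt]
    simp only [map_add, map_smul, inner_add_left, inner_add_right, inner_smul_left,
      inner_smul_right, h1, h2]
    rw [hE.inner_eq w, hE.inner_eq t, hS.inner_eq w, ← Complex.normSq_eq_norm_sq,
      Complex.normSq_apply]
    simp
    ring
  -- Since `εt = σw`, Cauchy–Schwarz for `σ` gives `⟨t, εt⟩² ≤ ⟨t, σt⟩ ⟨w, σw⟩ ≤ (σmax / εmin) ⟨t,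
  -- εt⟩ ⟨w, σw⟩`; one factor `⟨t, εt⟩` cancels.
  have hτ : (⟪t, E t⟫_ℂ).re ≤ σmax / εmin * (⟪w, S w⟫_ℂ).re := by
    have h1 := hS.cauchy_schwarz hσ t w
    have h2 : ‖⟪t, S w⟫_ℂ‖ = (⟪t, E t⟫_ℂ).re := by
      rw [← hEt]
      nth_rw 1 [hE.inner_eq]
      rw [Complex.norm_real, Real.norm_of_nonneg (hE.inner_nonneg hε.le t)]
    rw [h2] at h1
    have h3 := inner_le_div_mul_inner hε hE hσm hS t
    have h4 := mul_le_mul_of_nonneg_right h3 (hS.inner_nonneg hσ w)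
    rcases (hE.inner_nonneg hε.le t).eq_or_lt with h0 | h0
    · rw [← h0]
      exact mul_nonneg (div_nonneg hσm hε.le) (hS.inner_nonneg hσ w)
    · refine le_of_mul_le_mul_left ?_ h0
      nlinarith
  -- The sign of `εmax` is not assumed; it is read off from a nonzero vector.
  rcases eq_or_ne w 0 with rfl | hw
  · simp
  have hεm' : 0 ≤ εmax := by
    have h1 := hE.lower w
    have h2 : 0 < (⟪w, E w⟫_ℂ).re := lt_of_lt_of_le (by positivity) h1
    exact nonneg_of_mul_nonneg_left hεm h2
  rw [hy]
  refine (hE.norm_sq_le hε.le _).trans (mul_le_mul_of_nonneg_left ?_ hεm')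
  rw [hform]
  refine mul_le_mul_of_nonneg_left ?_ (sq_nonneg _)
  linarith

/-- The Schur complement is bounded below for non-imaginary `ω` outside the enclosure. The
constant `l` bounds the form of `A* A` from below on a complement of a subspace of `ker A`. -/
theorem le_norm_schurOp_of_re_ne_zero {ι A : V →L[ℂ] H} {N E S : H →L[ℂ] H}
    {εmin εmax μmax σmin σmax l : ℝ}
    (hVn : ∀ v, ‖v‖ ^ 2 = ‖ι v‖ ^ 2 + ‖A v‖ ^ 2)
    (hNs : (N : H →ₗ[ℂ] H).IsSymmetric) (hN : ∀ w, ‖w‖ ^ 2 ≤ μmax * (⟪w, N w⟫_ℂ).re)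
    (hμ : 0 < μmax) (hε : 0 < εmin) (hεm : 0 < εmax) (hE : SymmBounds E εmin εmax)
    (hσ : 0 ≤ σmin) (hσm : 0 ≤ σmax) (hS : SymmBounds S σmin σmax) (hl : 0 ≤ l)
    (hker : ∀ v, ∃ g, A g = 0 ∧ ‖g‖ ≤ ‖v‖ ∧ l * ‖ι v - ι g‖ ^ 2 ≤ ‖A v‖ ^ 2)
    {ω : ℂ} (hre : ω.re ≠ 0)
    (hout : ¬ (ω.im ∈ Set.Icc (-(1 / 2 * (σmax / εmin))) (-(1 / 2 * (σmin / εmax))) ∧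
        l / (εmax * μmax) ≤
          ω.re ^ 2 - 3 * ω.im ^ 2 + 2 * (σmax / εmin) * |ω.im|)) :
    ∃ c > 0, ∀ u, c * ‖u‖ ≤ ‖schurOp ι A N E S ω u‖ := by
  by_contra hcon
  obtain ⟨v, hv, hlim⟩ := exists_seq_of_not_bounded_below hcon
  choose g hg hgn hgl using hker
  set e : ℕ → ℝ := fun n => (⟪ι (v n), E (ι (v n))⟫_ℂ).re with he
  set s : ℕ → ℝ := fun n => (⟪ι (v n), S (ι (v n))⟫_ℂ).re with hs
  set a : ℕ → ℝ := fun n => (⟪A (v n), N (A (v n))⟫_ℂ).re with ha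
  have hNA : ∀ n, ⟪A (v n), N (A (v n))⟫_ℂ = (a n : ℂ) := fun n =>
    inner_eq_re_of_symmetric hNs _
  have hC : ∀ n, ⟪ι (v n), ω ^ 2 • E (ι (v n)) + (Complex.I * ω) • S (ι (v n))⟫_ℂ =
      ω ^ 2 * (e n : ℂ) + Complex.I * ω * (s n : ℂ) := by
    intro n
    rw [inner_add_right, inner_smul_right, inner_smul_right, hE.inner_eq, hS.inner_eq]
  have hz : ∀ w : ℕ → V, (∀ n, ‖w n‖ ≤ 1) →
      Tendsto (fun n => ⟪w n, schurOp ι A N E S ω (v n)⟫_ℂ) atTop (𝓝 0) := by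
    intro w hw
    refine squeeze_zero_norm (fun n => ?_) hlim
    refine (norm_inner_le_norm _ _).trans ?_
    exact mul_le_of_le_one_left (norm_nonneg _) (hw n)
  have hz1 := hz v fun n => (hv n).le
  -- Testing with `g (v n)` removes the curl term, because `A (g (v n)) = 0`.
  have hz2 := hz (fun n => g (v n)) fun n => (hgn _).trans (hv n).le
  simp only [inner_schurOp, hNA, hC] at hz1
  simp only [inner_schurOp, hg, inner_zero_left, zero_sub] at hz2
  refine hout (enclosure_of_limits (εmin := εmin) hre hμ hεm (div_nonneg hσm hε.le) e s a
    (fun n => -⟪ι (g (v n)), ω ^ 2 • E (ι (v n)) + (Complex.I * ω) • S (ι (v n))⟫_ℂ)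
    hz1 hz2 (fun n => hE.inner_nonneg hε.le _) ?_ (fun n => ?_) (fun n => ?_) (fun n => ?_)
    (fun n => ?_))
  · refine ⟨εmax, fun n => (hE.upper _).trans ?_⟩
    have h1 := hVn (v n)
    rw [hv] at h1
    have : ‖ι (v n)‖ ^ 2 ≤ 1 := by nlinarith [sq_nonneg ‖A (v n)‖]
    exact mul_le_of_le_one_right hεm.le this
  · rw [div_mul_eq_mul_div, div_le_iff₀ hεm]
    have h1 := mul_le_mul_of_nonneg_left (hE.upper (ι (v n))) hσ
    have h2 := mul_le_mul_of_nonneg_left (hS.lower (ι (v n))) hεm.le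
    linarith
  · exact inner_le_div_mul_inner hε hE hσm hS _
  · have h1 := hVn (v n)
    rw [hv, one_pow] at h1
    rw [h1]
    refine add_le_add ?_ (hN _)
    rw [inv_mul_eq_div, le_div_iff₀' hε]
    exact hE.lower _
  -- Adding the null sequence replaces `ι v` by `ι v - ι g` in the first slot, where `hgl` supplies
  -- the constant `l`.
  · have h1 : ω ^ 2 * (e n : ℂ) + Complex.I * ω * (s n : ℂ)
        + -⟪ι (g (v n)), ω ^ 2 • E (ι (v n)) + (Complex.I * ω) • S (ι (v n))⟫_ℂ =
        ⟪ι (v n) - ι (g (v n)), ω ^ 2 • E (ι (v n)) + (Complex.I * ω) • S (ι (v n))⟫_ℂ := by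
      rw [inner_sub_left, hC]
      ring
    rw [h1]
    have h2 := norm_inner_le_norm (𝕜 := ℂ) (ι (v n) - ι (g (v n)))
      (ω ^ 2 • E (ι (v n)) + (Complex.I * ω) • S (ι (v n)))
    have h3 := pow_le_pow_left₀ (norm_nonneg _) h2 2
    rw [mul_pow] at h3
    have h4 := norm_sq_coefficient_le hε hE hσ hσm hS ω (ι (v n))
    have h5 := (hgl (v n)).trans (hN _)
    calc _ ≤ l * (‖ι (v n) - ι (g (v n))‖ ^ 2 *
          ‖ω ^ 2 • E (ι (v n)) + (Complex.I * ω) • S (ι (v n))‖ ^ 2) :=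
        mul_le_mul_of_nonneg_left h3 hl
      _ = (l * ‖ι (v n) - ι (g (v n))‖ ^ 2) *
          ‖ω ^ 2 • E (ι (v n)) + (Complex.I * ω) • S (ι (v n))‖ ^ 2 := by ring
      _ ≤ (μmax * a n) * _ :=
        mul_le_mul h5 h4 (sq_nonneg _) (le_trans (by positivity) h5)

end SchurComplement

variable {Ω : TopologicalSpace.Opens R3}

theorem ae_vol_neBot (hΩ : (Ω : Set R3).Nonempty) : (ae (vol Ω)).NeBot := by
  rw [ae_neBot, Ne, Measure.restrict_eq_zero]
  exact (Ω.isOpen.measure_pos volume hΩ).ne'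

/-! ### Multiplication by a coefficient as a bounded symmetric operator. -/

namespace Coefficient

variable (M : Coefficient Ω)

/-- On an empty set any two numbers would be bounds. Non-emptiness provides a point at which the
bounds hold, so the upper bounds inherit the sign of the lower ones. -/
theorem BoundedBy.le {M : Coefficient Ω} {a b : ℝ} (h : M.BoundedBy a b)
    (hΩ : (Ω : Set R3).Nonempty) : a ≤ b := by
  have := ae_vol_neBot hΩ
  obtain ⟨x, hx⟩ := h.exists
  have := hx (Pi.single 0 1) (by simp)
  exact this.1.trans this.2

theorem quadratic_bounds {P : Matrix (Fin 3) (Fin 3) ℝ} {a b : ℝ}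
    (h : ∀ η : Fin 3 → ℝ, η ⬝ᵥ η = 1 → a ≤ η ⬝ᵥ P.mulVec η ∧ η ⬝ᵥ P.mulVec η ≤ b)
    (η : Fin 3 → ℝ) : a * (η ⬝ᵥ η) ≤ η ⬝ᵥ P.mulVec η ∧ η ⬝ᵥ P.mulVec η ≤ b * (η ⬝ᵥ η) := by
  rcases eq_or_ne η 0 with rfl | hη
  · simp
  have hq : 0 < η ⬝ᵥ η := by
    refine lt_of_le_of_ne ?_ fun h0 => hη (dotProduct_self_eq_zero.1 h0.symm)
    exact Finset.sum_nonneg fun i _ => mul_self_nonneg _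
  have hs : √(η ⬝ᵥ η) * √(η ⬝ᵥ η) = η ⬝ᵥ η := Real.mul_self_sqrt hq.le
  have hs0 : √(η ⬝ᵥ η) ≠ 0 := (Real.sqrt_pos.2 hq).ne'
  obtain ⟨h1, h2⟩ := h ((√(η ⬝ᵥ η))⁻¹ • η) (by
    rw [smul_dotProduct, dotProduct_smul, smul_eq_mul, smul_eq_mul, ← mul_assoc, ← mul_inv, hs,
      inv_mul_cancel₀ hq.ne'])
  rw [Matrix.mulVec_smul, smul_dotProduct, dotProduct_smul, smul_eq_mul, smul_eq_mul,
    ← mul_assoc, ← mul_inv, hs, inv_mul_eq_div] at h1 h2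
  exact ⟨(le_div_iff₀ hq).1 h1, (div_le_iff₀ hq).1 h2⟩

theorem inner_act_symm {x : R3} (h : (M.val x).IsSymm) (z w : C3) :
    ⟪M.act x z, w⟫_ℂ = ⟪z, M.act x w⟫_ℂ := by
  have h1 := h.apply 0 1
  have h2 := h.apply 0 2
  have h3 := h.apply 1 2
  simp [act, PiLp.inner_apply, Fin.sum_univ_three, Matrix.mulVec, dotProduct, h1, h2, h3]
  ring

/-- The cross terms between real and imaginary parts are purely imaginary; hence bounds over real
unit vectors control complex fields. -/
theorem re_inner_act (x : R3) (z : C3) :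
    (⟪z, M.act x z⟫_ℂ).re =
      (fun i => (z i).re) ⬝ᵥ (M.val x).mulVec (fun i => (z i).re) +
        (fun i => (z i).im) ⬝ᵥ (M.val x).mulVec (fun i => (z i).im) := by
  simp [act, PiLp.inner_apply, Fin.sum_univ_three, Matrix.mulVec, dotProduct]
  ring

theorem re_inner_self (z : C3) :
    (⟪z, z⟫_ℂ).re = (fun i => (z i).re) ⬝ᵥ (fun i => (z i).re) +
        (fun i => (z i).im) ⬝ᵥ (fun i => (z i).im) := by
  simp [PiLp.inner_apply, Fin.sum_univ_three, dotProduct, -inner_self_eq_norm_sq_to_K]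
  ring

theorem mulOp_ae (u : L2 Ω) : M.mulOp u =ᵐ[vol Ω] fun x => M.act x (u x) :=
  (M.memLp_act u).coeFn_toLp

/-- Symmetry also gives continuity: an everywhere defined symmetric operator on a Hilbert space is
bounded (Hellinger–Toeplitz). -/
theorem mulOp_isSymmetric : M.mulOp.IsSymmetric := by
  intro u v
  rw [L2.inner_def, L2.inner_def]
  refine integral_congr_ae ?_
  filter_upwards [M.mulOp_ae u, M.mulOp_ae v, M.symm] with x hu hv hs
  rw [hu, hv, M.inner_act_symm hs]

/-- The operator of multiplication by `M`, as a bounded operator. -/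
noncomputable def mulCLM : L2 Ω →L[ℂ] L2 Ω := ⟨M.mulOp, M.mulOp_isSymmetric.continuous⟩

theorem re_inner_eq_integral (u v : L2 Ω) :
    (⟪u, v⟫_ℂ).re = ∫ x, (⟪u x, v x⟫_ℂ).re ∂(vol Ω) := by
  rw [L2.inner_def]
  exact (integral_re (L2.integrable_inner (𝕜 := ℂ) u v)).symm

theorem symmBounds_mulCLM {M : Coefficient Ω} {a b : ℝ} (h : M.BoundedBy a b) :
    SymmBounds M.mulCLM a b := by
  have hi : ∀ u v : L2 Ω, Integrable (fun x => (⟪u x, v x⟫_ℂ).re) (vol Ω) := fun u v =>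
    (L2.integrable_inner (𝕜 := ℂ) u v).re
  have hn : ∀ u : L2 Ω, ‖u‖ ^ 2 = ∫ x, (⟪u x, u x⟫_ℂ).re ∂(vol Ω) := fun u => by
    rw [← re_inner_eq_integral]
    exact norm_sq_eq_re_inner (𝕜 := ℂ) u
  refine ⟨M.mulOp_isSymmetric, fun u => ?_, fun u => ?_⟩
  · rw [hn, re_inner_eq_integral, ← integral_const_mul]
    refine integral_mono_ae ((hi u u).const_mul a) (hi _ _) ?_
    filter_upwards [M.mulOp_ae u, h] with x hx hb
    change _ ≤ (⟪u x, M.mulOp u x⟫_ℂ).re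
    rw [hx, re_inner_act, re_inner_self]
    linarith [(quadratic_bounds hb fun i => (u x i).re).1,
      (quadratic_bounds hb fun i => (u x i).im).1]
  · rw [hn, re_inner_eq_integral, ← integral_const_mul]
    refine integral_mono_ae (hi _ _) ((hi u u).const_mul b) ?_
    filter_upwards [M.mulOp_ae u, h] with x hx hb
    change (⟪u x, M.mulOp u x⟫_ℂ).re ≤ _
    rw [hx, re_inner_act, re_inner_self]
    linarith [(quadratic_bounds hb fun i => (u x i).re).2,
      (quadratic_bounds hb fun i => (u x i).im).2]

end Coefficient

/-! ### Graph spaces of `curl₀` -/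

/-- The graph of the restriction of `curl₀` to the fields in `W`. -/
def graphSpace (W : Submodule ℂ (L2 Ω)) : Submodule ℂ (L2Pair Ω) where
  carrier := {p | p.fst ∈ W ∧ ∀ q ∈ curlGraph Ω, ⟪q.1, p.snd⟫_ℂ = ⟪q.2, p.fst⟫_ℂ}
  zero_mem' := ⟨W.zero_mem, fun q _ => by simp⟩
  add_mem' := fun ha hb => ⟨W.add_mem ha.1 hb.1, fun q hq => by
    simp [inner_add_right, ha.2 q hq, hb.2 q hq]⟩
  smul_mem' := fun c _ ha => ⟨W.smul_mem c ha.1, fun q hq => by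
    simp [inner_smul_right, ha.2 q hq]⟩

/-- The graph is described by duality with the graph of `curl`, hence by closed conditions. The
graph spaces thus become Hilbert spaces. -/
theorem isClosed_graphSpace {W : Submodule ℂ (L2 Ω)} (hW : IsClosed (W : Set (L2 Ω))) :
    IsClosed (graphSpace W : Set (L2Pair Ω)) := by
  have h1 : Continuous fun p : L2Pair Ω => p.fst := (WithLp.fstL 2 ℂ _ _).continuous
  have h2 : Continuous fun p : L2Pair Ω => p.snd := (WithLp.sndL 2 ℂ _ _).continuous
  have : (graphSpace W : Set (L2Pair Ω)) = {p | p.fst ∈ W} ∩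
      ⋂ q ∈ curlGraph Ω, {p | ⟪q.1, p.snd⟫_ℂ = ⟪q.2, p.fst⟫_ℂ} := by
    ext p
    simp [graphSpace]
  rw [this]
  refine (hW.preimage h1).inter (isClosed_biInter fun q _ => ?_)
  exact isClosed_eq (continuous_const.inner h2) (continuous_const.inner h1)

theorem mem_graphSpace_iff {W : Submodule ℂ (L2 Ω)} {p : L2Pair Ω} :
    p ∈ graphSpace W ↔ p.fst ∈ W ∧ ∃ h : p.fst ∈ (curl0 Ω).domain, curl0 Ω ⟨p.fst, h⟩ = p.snd := by
  refine and_congr_right fun _ => ⟨fun h => ?_, ?_⟩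
  · have hw : IsWeakCurl Ω p.fst p.snd := by
      rw [isWeakCurl_iff]
      intro φ hφ
      exact (h (hφ.toL2, hφ.classicalCurl.toL2) hφ.isWeakCurl).symm
    have hd : p.fst ∈ (curl Ω).domain := mem_curl_domain.2 ⟨_, hw⟩
    have hc : curl Ω ⟨p.fst, hd⟩ = p.snd := curl_eq_of_isWeakCurl ⟨p.fst, hd⟩ hw
    refine ⟨⟨hd, fun v => ?_⟩, hc⟩
    have := h (v, curl Ω v) (curl_spec v)
    rw [hc, ← inner_conj_symm, this, inner_conj_symm]
  · rintro ⟨⟨hd, h⟩, hp⟩ q hq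
    have hq1 : q.1 ∈ (curl Ω).domain := mem_curl_domain.2 ⟨_, hq⟩
    have := h ⟨q.1, hq1⟩
    rw [curl_eq_of_isWeakCurl ⟨q.1, hq1⟩ hq] at this
    rw [← hp, curl0_apply, ← inner_conj_symm, this, inner_conj_symm]

/-- The embedding of a graph space into `L²(Ω)³`. -/
noncomputable def fieldMap (W : Submodule ℂ (L2 Ω)) : graphSpace W →L[ℂ] L2 Ω :=
  WithLp.fstL 2 ℂ _ _ ∘L (graphSpace W).subtypeL

/-- The operator `curl₀` on a graph space. -/
noncomputable def curlMap (W : Submodule ℂ (L2 Ω)) : graphSpace W →L[ℂ] L2 Ω :=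
  WithLp.sndL 2 ℂ _ _ ∘L (graphSpace W).subtypeL

theorem norm_sq_graphSpace {W : Submodule ℂ (L2 Ω)} (v : graphSpace W) :
    ‖v‖ ^ 2 = ‖fieldMap W v‖ ^ 2 + ‖curlMap W v‖ ^ 2 :=
  WithLp.prod_norm_sq_eq_of_L2 _

theorem fieldMap_mem {W : Submodule ℂ (L2 Ω)} (v : graphSpace W) : fieldMap W v ∈ W := v.2.1

theorem fieldMap_mem_domain {W : Submodule ℂ (L2 Ω)} (v : graphSpace W) :
    fieldMap W v ∈ (curl0 Ω).domain := (mem_graphSpace_iff.1 v.2).2.1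

theorem curl0_fieldMap {W : Submodule ℂ (L2 Ω)} (v : graphSpace W) :
    curl0 Ω ⟨fieldMap W v, fieldMap_mem_domain v⟩ = curlMap W v := (mem_graphSpace_iff.1 v.2).2.2

/-- An element of a graph space from an element of the domain of `curl₀`. -/
noncomputable def toGraphSpace {W : Submodule ℂ (L2 Ω)} (u : (curl0 Ω).domain) (hu : (u : L2 Ω) ∈ W) :
    graphSpace W :=
  ⟨WithLp.toLp 2 ((u : L2 Ω), curl0 Ω u), mem_graphSpace_iff.2 ⟨hu, u.2, rfl⟩⟩

theorem fieldMap_toGraphSpace {W : Submodule ℂ (L2 Ω)} (u : (curl0 Ω).domain)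
    (hu : (u : L2 Ω) ∈ W) : fieldMap W (toGraphSpace u hu) = u := rfl

theorem curlMap_toGraphSpace {W : Submodule ℂ (L2 Ω)} (u : (curl0 Ω).domain)
    (hu : (u : L2 Ω) ∈ W) : curlMap W (toGraphSpace u hu) = curl0 Ω u := rfl

/-- Green's formula for `curl` and `curl₀`. -/
theorem inner_curlMap {W : Submodule ℂ (L2 Ω)} (v : graphSpace W) (w : (curl Ω).domain) :
    ⟪curlMap W v, (w : L2 Ω)⟫_ℂ = ⟪fieldMap W v, curl Ω w⟫_ℂ := by
  have := v.2.2 (w, curl Ω w) (curl_spec w)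
  rw [← inner_conj_symm]
  erw [this]
  exact inner_conj_symm _ _

theorem IsTest.mem_curl0_domain {φ : R3 → C3} (h : IsTest Ω φ) : h.toL2 ∈ (curl0 Ω).domain := by
  refine ⟨h.mem_curl_domain, fun v => ?_⟩
  rw [curl_eq_of_isWeakCurl ⟨_, h.mem_curl_domain⟩ h.isWeakCurl]
  exact isWeakCurl_iff.1 (curl_spec v) φ h

theorem IsTest.curl0_toL2 {φ : R3 → C3} (h : IsTest Ω φ) :
    curl0 Ω ⟨h.toL2, h.mem_curl0_domain⟩ = h.classicalCurl.toL2 :=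
  curl_eq_of_isWeakCurl ⟨_, h.mem_curl_domain⟩ h.isWeakCurl

/-- `curl` is the adjoint of `curl₀`. -/
theorem isWeakCurl_of_forall_graphSpace {h w : L2 Ω}
    (H : ∀ v : graphSpace (⊤ : Submodule ℂ (L2 Ω)),
      ⟪curlMap ⊤ v, h⟫_ℂ = ⟪fieldMap ⊤ v, w⟫_ℂ) : IsWeakCurl Ω h w := by
  rw [isWeakCurl_iff]
  intro φ hφ
  have := H (toGraphSpace ⟨_, hφ.mem_curl0_domain⟩ trivial)
  erw [curlMap_toGraphSpace, fieldMap_toGraphSpace, hφ.curl0_toL2] at this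
  exact this

/-! ### The Helmholtz decomposition -/

theorem isClosed_Hdiv0 : IsClosed (Hdiv0 Ω : Set (L2 Ω)) := by
  have : (Hdiv0 Ω : Set (L2 Ω)) =
      ⋂ (φ : R3 → ℂ) (h : IsTest Ω φ), {u | ⟪h.classicalGrad.toL2, u⟫_ℂ = 0} := by
    ext u
    simp only [Set.mem_iInter]
    exact isWeakDivFree_iff
  rw [this]
  exact isClosed_iInter fun φ => isClosed_iInter fun h =>
    isClosed_eq (continuous_const.inner continuous_id) continuous_const

instance : CompleteSpace (Hdiv0 Ω) := isClosed_Hdiv0.completeSpace_coe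

instance : CompleteSpace (graphSpace (⊤ : Submodule ℂ (L2 Ω))) :=
  (isClosed_graphSpace isClosed_univ).completeSpace_coe

instance : CompleteSpace (graphSpace (Hdiv0 Ω)) :=
  (isClosed_graphSpace isClosed_Hdiv0).completeSpace_coe

/-- Fields orthogonal to the divergence-free ones lie in the kernel of `curl₀`. -/
theorem orthogonal_Hdiv0_le {w : L2 Ω} (hw : w ∈ (Hdiv0 Ω)ᗮ) :
    ∃ h : w ∈ (curl0 Ω).domain, curl0 Ω ⟨w, h⟩ = 0 := by
  have hp : WithLp.toLp 2 (w, (0 : L2 Ω)) ∈ graphSpace (⊤ : Submodule ℂ (L2 Ω)) := by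
    refine ⟨trivial, fun q hq => ?_⟩
    have hq1 : q.1 ∈ (curl Ω).domain := mem_curl_domain.2 ⟨_, hq⟩
    have hq2 : curl Ω ⟨q.1, hq1⟩ = q.2 := curl_eq_of_isWeakCurl ⟨q.1, hq1⟩ hq
    -- The range of `curl` is divergence-free, so `w` is orthogonal to it and lies in the kernel of
    -- the adjoint.
    have := (Submodule.mem_orthogonal _ _).1 hw _ (hq2 ▸ curl_mem_Hdiv0 Ω ⟨q.1, hq1⟩)
    simp [this]
  exact (mem_graphSpace_iff.1 hp).2

/-- The orthogonal projection onto the complement of `Hdiv0 Ω` lands in the kernel of `curl₀`. Both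
components therefore stay in the form domain, and the divergence-free one keeps the whole curl. -/
theorem exists_helmholtz (v : graphSpace (⊤ : Submodule ℂ (L2 Ω))) :
    ∃ (g : graphSpace (⊤ : Submodule ℂ (L2 Ω))) (v₀ : graphSpace (Hdiv0 Ω)),
      curlMap ⊤ g = 0 ∧ ‖g‖ ≤ ‖v‖ ∧ fieldMap ⊤ g ∈ (Hdiv0 Ω)ᗮ ∧
      fieldMap (Hdiv0 Ω) v₀ = fieldMap ⊤ v - fieldMap ⊤ g ∧
      curlMap (Hdiv0 Ω) v₀ = curlMap ⊤ v := by
  have hw : (Hdiv0 Ω)ᗮ.starProjection (fieldMap ⊤ v) ∈ (Hdiv0 Ω)ᗮ :=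
    Submodule.starProjection_apply_mem _ _
  obtain ⟨hd, h0⟩ := orthogonal_Hdiv0_le hw
  set g : graphSpace (⊤ : Submodule ℂ (L2 Ω)) := toGraphSpace ⟨_, hd⟩ trivial
  have hg0 : curlMap ⊤ g = 0 := h0
  have hgf : fieldMap ⊤ g = (Hdiv0 Ω)ᗮ.starProjection (fieldMap ⊤ v) := rfl
  have hmem : fieldMap ⊤ (v - g) ∈ Hdiv0 Ω := by
    rw [map_sub, hgf, Submodule.starProjection_orthogonal_val, sub_sub_cancel]
    exact Submodule.starProjection_apply_mem _ _
  refine ⟨g, toGraphSpace ⟨_, fieldMap_mem_domain (v - g)⟩ hmem, hg0, ?_, hw, ?_, ?_⟩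
  · refine pow_le_pow_iff_left₀ (norm_nonneg _) (norm_nonneg _) two_ne_zero |>.1 ?_
    rw [norm_sq_graphSpace, norm_sq_graphSpace, hg0, hgf]
    have h1 := Submodule.norm_starProjection_apply_le (Hdiv0 Ω)ᗮ (fieldMap ⊤ v)
    have h2 := pow_le_pow_left₀ (norm_nonneg _) h1 2
    simp only [norm_zero]
    nlinarith [sq_nonneg ‖curlMap ⊤ v‖]
  · exact (fieldMap_toGraphSpace _ hmem).trans (map_sub _ _ _)
  · rw [curlMap_toGraphSpace, curl0_fieldMap, map_sub, hg0, sub_zero]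

/-! ### The spectrum of `curl curl₀` on divergence-free fields -/

section CurlCurl

open ContinuousLinearMap

theorem inner_adjoint_comp_sub {V H : Type} [NormedAddCommGroup V] [InnerProductSpace ℂ V]
    [CompleteSpace V] [NormedAddCommGroup H] [InnerProductSpace ℂ H] [CompleteSpace H]
    (ι A : V →L[ℂ] H) (z : ℂ) (u v : V) :
    ⟪u, (adjoint A ∘L A - z • (adjoint ι ∘L ι)) v⟫_ℂ = ⟪A u, A v⟫_ℂ - z * ⟪ι u, ι v⟫_ℂ := by
  simp [adjoint_inner_right]

/-- The operator of the form `⟨curl₀ u, curl₀ v⟩ - z ⟨u, v⟩` in the form domain. -/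
noncomputable def formOp (Ω : TopologicalSpace.Opens R3) (z : ℂ) :
    graphSpace (Hdiv0 Ω) →L[ℂ] graphSpace (Hdiv0 Ω) :=
  adjoint (curlMap (Hdiv0 Ω)) ∘L curlMap (Hdiv0 Ω)
    - z • (adjoint (fieldMap (Hdiv0 Ω)) ∘L fieldMap (Hdiv0 Ω))

theorem inner_formOp (z : ℂ) (u v : graphSpace (Hdiv0 Ω)) :
    ⟪u, formOp Ω z v⟫_ℂ =
      ⟪curlMap _ u, curlMap _ v⟫_ℂ - z * ⟪fieldMap _ u, fieldMap _ v⟫_ℂ :=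
  inner_adjoint_comp_sub _ _ z u v

theorem inner_formOp_self (z : ℂ) (v : graphSpace (Hdiv0 Ω)) :
    ⟪v, formOp Ω z v⟫_ℂ =
      ((‖curlMap _ v‖ ^ 2 : ℝ) : ℂ) - z * ((‖fieldMap _ v‖ ^ 2 : ℝ) : ℂ) := by
  rw [inner_formOp, inner_self_eq_norm_sq_to_K, inner_self_eq_norm_sq_to_K]
  push_cast
  rfl

/-- Control of the `L²` norm suffices for Lax–Milgram in the graph norm, since the form itself
bounds `‖curl₀ v‖²` up to `‖z‖ ‖v‖²`. -/
theorem isUnit_formOp {z : ℂ} {d : ℝ} (hd : 0 < d)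
    (h : ∀ v : graphSpace (Hdiv0 Ω), d * ‖fieldMap _ v‖ ^ 2 ≤ ‖⟪v, formOp Ω z v⟫_ℂ‖) :
    IsUnit (formOp Ω z) := by
  have hc : 0 < 1 + (‖z‖ + 1) / d := by positivity
  refine ContinuousLinearMap.isUnit_of_forall_le_norm_inner_map _
    (c := ⟨(1 + (‖z‖ + 1) / d)⁻¹, by positivity⟩) (inv_pos.2 hc) fun v => ?_
  rw [← inner_conj_symm, RCLike.norm_conj]
  change ‖v‖ ^ 2 * (1 + (‖z‖ + 1) / d)⁻¹ ≤ _
  rw [← div_eq_mul_inv, div_le_iff₀ hc, norm_sq_graphSpace]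
  have h1 : ‖fieldMap _ v‖ ^ 2 ≤ ‖⟪v, formOp Ω z v⟫_ℂ‖ / d := by
    rw [le_div_iff₀' hd]
    exact h v
  have h2 : ‖curlMap _ v‖ ^ 2 ≤ ‖⟪v, formOp Ω z v⟫_ℂ‖ + ‖z‖ * ‖fieldMap _ v‖ ^ 2 := by
    have e : ((‖curlMap _ v‖ ^ 2 : ℝ) : ℂ) =
        ⟪v, formOp Ω z v⟫_ℂ + z * ((‖fieldMap _ v‖ ^ 2 : ℝ) : ℂ) := by
      rw [inner_formOp_self]
      ring
    have := norm_add_le ⟪v, formOp Ω z v⟫_ℂ (z * ((‖fieldMap _ v‖ ^ 2 : ℝ) : ℂ))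
    rwa [← e, norm_mul, Complex.norm_real, Complex.norm_real, Real.norm_of_nonneg (sq_nonneg _),
      Real.norm_of_nonneg (sq_nonneg _)] at this
  have h3 := mul_le_mul_of_nonneg_left h1 (by positivity : 0 ≤ ‖z‖ + 1)
  calc _ ≤ ‖⟪v, formOp Ω z v⟫_ℂ‖ + (‖z‖ + 1) * ‖fieldMap _ v‖ ^ 2 := by linarith
    _ ≤ ‖⟪v, formOp Ω z v⟫_ℂ‖ + (‖z‖ + 1) * (‖⟪v, formOp Ω z v⟫_ℂ‖ / d) := by linarith
    _ = _ := by ring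

/-- The operator `curl curl₀ - z`. -/
noncomputable abbrev shiftedCurlCurl (Ω : TopologicalSpace.Opens R3) (z : ℂ) :
    Hdiv0 Ω →ₗ.[ℂ] Hdiv0 Ω :=
  (-(z • (LinearMap.id : Hdiv0 Ω →ₗ[ℂ] Hdiv0 Ω))) +ᵥ curlCurl0 Ω

/-- The graph space element of a field in the domain of `curl curl₀`. -/
noncomputable def domainToGraph (z : ℂ) (x : (shiftedCurlCurl Ω z).domain) :
    graphSpace (Hdiv0 Ω) :=
  toGraphSpace ⟨((x : Hdiv0 Ω) : L2 Ω), x.2.1⟩ (x : Hdiv0 Ω).2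

theorem inner_formOp_domainToGraph (z : ℂ) (x : (shiftedCurlCurl Ω z).domain)
    (u : graphSpace (Hdiv0 Ω)) :
    ⟪u, formOp Ω z (domainToGraph z x)⟫_ℂ =
      ⟪fieldMap _ u, ((shiftedCurlCurl Ω z x : Hdiv0 Ω) : L2 Ω)⟫_ℂ := by
  have h : ((shiftedCurlCurl Ω z x : Hdiv0 Ω) : L2 Ω) =
      -(z • ((x : Hdiv0 Ω) : L2 Ω)) + curl Ω ⟨curl0 Ω ⟨(x : Hdiv0 Ω), x.2.1⟩, x.2.2⟩ := rfl
  rw [h, inner_add_right, inner_neg_right, inner_smul_right, ← inner_curlMap, inner_formOp,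
    neg_add_eq_sub]
  rfl

theorem formOp_domainToGraph (z : ℂ) (x : (shiftedCurlCurl Ω z).domain) :
    formOp Ω z (domainToGraph z x) =
      adjoint (fieldMap (Hdiv0 Ω)) ((shiftedCurlCurl Ω z x : Hdiv0 Ω) : L2 Ω) := by
  refine ext_inner_left ℂ fun u => ?_
  rw [inner_formOp_domainToGraph, adjoint_inner_right]

/-- The hypothesis tests only with divergence-free fields, whereas a weak curl must be tested with
all of `H₀(curl)`. The remaining Helmholtz component has zero curl and is orthogonal to `f` and `v`,
so it contributes nothing. -/
theorem exists_domain_of_weak_solution {z : ℂ} {v : graphSpace (Hdiv0 Ω)} {f : Hdiv0 Ω}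
    (h : ∀ u, ⟪u, formOp Ω z v⟫_ℂ = ⟪fieldMap _ u, (f : L2 Ω)⟫_ℂ) :
    ∃ x : (shiftedCurlCurl Ω z).domain, shiftedCurlCurl Ω z x = f := by
  have hw : IsWeakCurl Ω (curlMap _ v) ((f : L2 Ω) + z • fieldMap _ v) := by
    refine isWeakCurl_of_forall_graphSpace fun u => ?_
    obtain ⟨g, u₀, -, -, hg, hu, hc⟩ := exists_helmholtz u
    have h1 := h u₀
    have hf := (Submodule.mem_orthogonal' _ _).1 hg _ f.2
    have hv := (Submodule.mem_orthogonal' _ _).1 hg _ (fieldMap_mem v)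
    rw [inner_formOp, hu, hc, inner_sub_left, inner_sub_left, hf, hv, sub_zero, sub_zero] at h1
    rw [inner_add_right, inner_smul_right, ← h1, sub_add_cancel]
  have hd : curlMap _ v ∈ (curl Ω).domain := mem_curl_domain.2 ⟨_, hw⟩
  have hx : (⟨fieldMap _ v, fieldMap_mem v⟩ : Hdiv0 Ω) ∈ (shiftedCurlCurl Ω z).domain := by
    refine ⟨fieldMap_mem_domain v, ?_⟩
    rw [curl0_fieldMap]
    exact hd
  refine ⟨⟨_, hx⟩, Subtype.ext ?_⟩
  have hc : curl Ω ⟨curl0 Ω ⟨fieldMap _ v, fieldMap_mem_domain v⟩, hx.2⟩ =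
      (f : L2 Ω) + z • fieldMap _ v := by
    refine curl_eq_of_isWeakCurl _ ?_
    change IsWeakCurl Ω (curl0 Ω ⟨fieldMap _ v, fieldMap_mem_domain v⟩) _
    rwa [curl0_fieldMap]
  change -(z • fieldMap _ v) + curl Ω ⟨curl0 Ω ⟨fieldMap _ v, fieldMap_mem_domain v⟩, hx.2⟩ = _
  rw [hc]
  abel

theorem boundedlyInvertible_shiftedCurlCurl {z : ℂ} (h : IsUnit (formOp Ω z)) :
    BoundedlyInvertible (shiftedCurlCurl Ω z) := by
  obtain ⟨U, hU⟩ := h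
  have h1 : ∀ u, formOp Ω z ((↑U⁻¹ : _ →L[ℂ] graphSpace (Hdiv0 Ω)) u) = u := fun u => by
    rw [← hU]
    exact congrArg (fun T : _ →L[ℂ] graphSpace (Hdiv0 Ω) => T u) U.mul_inv
  have h2 : ∀ u, (↑U⁻¹ : _ →L[ℂ] graphSpace (Hdiv0 Ω)) (formOp Ω z u) = u := fun u => by
    rw [← hU]
    exact congrArg (fun T : _ →L[ℂ] graphSpace (Hdiv0 Ω) => T u) U.inv_mul
  set R : L2 Ω →L[ℂ] graphSpace (Hdiv0 Ω) := ↑U⁻¹ ∘L adjoint (fieldMap (Hdiv0 Ω)) with hR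
  have hx : ∀ x : (shiftedCurlCurl Ω z).domain,
      ((x : Hdiv0 Ω) : L2 Ω) = fieldMap _ (R (shiftedCurlCurl Ω z x : Hdiv0 Ω)) := by
    intro x
    rw [hR, comp_apply, ← formOp_domainToGraph, h2]
    rfl
  refine ⟨⟨fun x y hxy => ?_, fun f => ?_⟩, ‖fieldMap (Hdiv0 Ω) ∘L R‖, fun x => ?_⟩
  · refine Subtype.ext (Subtype.ext ?_)
    rw [hx x, hx y]
    exact congrArg (fun f : Hdiv0 Ω => fieldMap _ (R f)) hxy
  · refine exists_domain_of_weak_solution (v := R f) fun u => ?_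
    rw [hR, comp_apply, h1, adjoint_inner_right]
  · have := (fieldMap (Hdiv0 Ω) ∘L R).le_opNorm (shiftedCurlCurl Ω z x : Hdiv0 Ω)
    rw [comp_apply, ← hx x] at this
    exact this

/-- The Rayleigh quotients of `curl curl₀`. -/
def rayleighSet (Ω : TopologicalSpace.Opens R3) : Set ℝ :=
  {t | ∃ v : graphSpace (Hdiv0 Ω), ‖fieldMap _ v‖ = 1 ∧ ‖curlMap _ v‖ ^ 2 = t}

theorem bddBelow_rayleighSet : BddBelow (rayleighSet Ω) :=
  ⟨0, by rintro t ⟨v, -, rfl⟩; positivity⟩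

theorem sInf_rayleighSet_nonneg : 0 ≤ sInf (rayleighSet Ω) :=
  Real.sInf_nonneg (by rintro t ⟨v, -, rfl⟩; positivity)

theorem sInf_rayleighSet_mul_le (v : graphSpace (Hdiv0 Ω)) :
    sInf (rayleighSet Ω) * ‖fieldMap _ v‖ ^ 2 ≤ ‖curlMap _ v‖ ^ 2 := by
  rcases (norm_nonneg (fieldMap _ v)).eq_or_lt with h0 | h0
  · rw [← h0]
    simp
  have h1 : ‖curlMap _ v‖ ^ 2 / ‖fieldMap _ v‖ ^ 2 ∈ rayleighSet Ω := by
    refine ⟨((‖fieldMap _ v‖⁻¹ : ℝ) : ℂ) • v, ?_, ?_⟩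
    · rw [map_smul, norm_smul]
      simp [h0.ne']
    · rw [map_smul, norm_smul]
      simp [mul_pow]
      field_simp
  have := csInf_le bddBelow_rayleighSet h1
  rwa [le_div_iff₀ (by positivity)] at this

theorem boundedlyInvertible_of_notMem {z : ℂ} (hz : z.im ≠ 0 ∨ z.re < sInf (rayleighSet Ω)) :
    BoundedlyInvertible (shiftedCurlCurl Ω z) := by
  refine boundedlyInvertible_shiftedCurlCurl ?_
  rcases hz with hz | hz
  · refine isUnit_formOp (abs_pos.2 hz) fun v => ?_
    refine le_trans (le_of_eq ?_) (Complex.abs_im_le_norm _)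
    rw [inner_formOp_self, Complex.sub_im, Complex.ofReal_im, Complex.im_mul_ofReal, zero_sub,
      abs_neg, abs_mul, abs_of_nonneg (sq_nonneg ‖fieldMap _ v‖)]
  · refine isUnit_formOp (sub_pos.2 hz) fun v => ?_
    refine le_trans ?_ (Complex.re_le_norm _)
    rw [inner_formOp_self, Complex.sub_re, Complex.ofReal_re, Complex.re_mul_ofReal]
    linarith [sInf_rayleighSet_mul_le v]

/-- Let `q` be the form of `curl curl₀ - m`, which is non-negative. If the resolvent at `m` were
bounded by `C`, a unit field `v` of the form domain would be the image of some `x` with `q(v, x) =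
1` and `q(x, x) ≤ C`. Cauchy–Schwarz would give `q(v, v) ≥ 1 / C` for all such `v`, so `m` would not
be the infimum. -/
theorem sInf_rayleighSet_mem_opSpectrum (hne : (rayleighSet Ω).Nonempty) :
    ((sInf (rayleighSet Ω) : ℝ) : ℂ) ∈ opSpectrum (curlCurl0 Ω) := by
  set m := sInf (rayleighSet Ω) with hm
  rintro ⟨⟨-, hsurj⟩, C, hC⟩
  have hq : ∀ v, (⟪v, formOp Ω m v⟫_ℂ).re = ‖curlMap _ v‖ ^ 2 - m * ‖fieldMap _ v‖ ^ 2 := by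
    intro v
    rw [inner_formOp_self, Complex.sub_re, Complex.ofReal_re, Complex.re_ofReal_mul,
      Complex.ofReal_re]
  have hsymm : (formOp Ω m : graphSpace (Hdiv0 Ω) →ₗ[ℂ] graphSpace (Hdiv0 Ω)).IsSymmetric := by
    intro u v
    refine (inner_conj_symm _ _).symm.trans ?_
    change (starRingEnd ℂ) ⟪v, formOp Ω m u⟫_ℂ = ⟪u, formOp Ω m v⟫_ℂ
    rw [inner_formOp, inner_formOp]
    simp only [map_sub, map_mul, inner_conj_symm, Complex.conj_ofReal]
  have hpos : ∀ v, 0 ≤ (⟪v, formOp Ω m v⟫_ℂ).re := by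
    intro v
    rw [hq]
    linarith [sInf_rayleighSet_mul_le v]
  have key : ∀ v : graphSpace (Hdiv0 Ω), ‖fieldMap _ v‖ = 1 →
      1 ≤ (‖curlMap _ v‖ ^ 2 - m) * C := by
    intro v hv
    obtain ⟨x, hx⟩ := hsurj ⟨fieldMap _ v, fieldMap_mem v⟩
    have hx' : ((shiftedCurlCurl Ω m x : Hdiv0 Ω) : L2 Ω) = fieldMap _ v :=
      congrArg Subtype.val hx
    have h1 := inner_formOp_domainToGraph (m : ℂ) x v
    have h2 := inner_formOp_domainToGraph (m : ℂ) x (domainToGraph (m : ℂ) x)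
    rw [hx'] at h1 h2
    have h3 := cauchy_schwarz_of_nonneg _ hsymm hpos v (domainToGraph (m : ℂ) x)
    have h4 : ‖⟪v, formOp Ω m (domainToGraph (m : ℂ) x)⟫_ℂ‖ = 1 := by
      rw [h1, inner_self_eq_norm_sq_to_K, hv]
      simp
    have h5 : (⟪domainToGraph (m : ℂ) x, formOp Ω m (domainToGraph (m : ℂ) x)⟫_ℂ).re ≤ C := by
      rw [h2]
      refine (Complex.re_le_norm _).trans ((norm_inner_le_norm _ _).trans ?_)
      have h6 := hC x
      change ‖((x : Hdiv0 Ω) : L2 Ω)‖ ≤ C * ‖((shiftedCurlCurl Ω m x : Hdiv0 Ω) : L2 Ω)‖ at h6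
      rw [hx', hv, mul_one] at h6
      rw [hv, mul_one]
      exact h6
    have h7 : (1 : ℝ) ≤ (⟪v, formOp Ω m v⟫_ℂ).re *
        (⟪domainToGraph (m : ℂ) x, formOp Ω m (domainToGraph (m : ℂ) x)⟫_ℂ).re := by
      refine le_trans (le_of_eq ?_) h3
      erw [h4]
      norm_num
    have h8 := h7.trans (mul_le_mul_of_nonneg_left h5 (hpos v))
    rwa [hq, hv, one_pow, mul_one] at h8
  have hCpos : 0 < C := by
    obtain ⟨-, v, hv, -⟩ := hne
    have h1 := key v hv
    have h2 := hpos v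
    rw [hq, hv, one_pow, mul_one] at h2
    by_contra hneg
    have := mul_nonpos_of_nonneg_of_nonpos h2 (not_lt.1 hneg)
    linarith
  have hle : m + C⁻¹ ≤ m := by
    refine le_csInf hne ?_
    rintro t ⟨v, hv, rfl⟩
    have h1 := key v hv
    have h2 : 1 / C ≤ ‖curlMap _ v‖ ^ 2 - m := (div_le_iff₀ hCpos).2 h1
    rw [one_div] at h2
    linarith
  linarith [inv_pos.2 hCpos]

/-- A non-empty open set carries a test field with non-zero curl. -/
theorem exists_test_curl_ne_zero (hΩ : (Ω : Set R3).Nonempty) :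
    ∃ (φ : R3 → C3) (h : IsTest Ω φ), h.classicalCurl.toL2 ≠ 0 := by
  obtain ⟨c, hc⟩ := hΩ
  obtain ⟨f, hfs, hfc, hf, -, hf1⟩ :=
    exists_contDiff_tsupport_subset (n := (⊤ : ℕ∞)) (Ω.isOpen.mem_nhds hc)
  have hft : IsTest Ω f := ⟨hf, hfc, hfs⟩
  have h : IsTest Ω (fun x => (f x : ℝ) • (EuclideanSpace.single 0 (1 : ℂ) : C3)) :=
    hft.clm ((ContinuousLinearMap.id ℝ ℝ).smulRight (EuclideanSpace.single 0 (1 : ℂ) : C3))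
  set φ : R3 → C3 := fun x => (f x : ℝ) • (EuclideanSpace.single 0 (1 : ℂ) : C3) with hφ
  refine ⟨φ, h, fun h0 => ?_⟩
  have hcurl : ∀ x, classicalCurl φ x = 0 := by
    have h1 : classicalCurl φ =ᵐ[vol Ω] 0 :=
      h.classicalCurl.memLp.coeFn_toLp.symm.trans ((Lp.eq_zero_iff_ae_eq_zero).1 h0)
    have h2 : classicalCurl φ =ᵐ[volume] (fun _ => 0) := by
      filter_upwards [(ae_restrict_iff' Ω.isOpen.measurableSet).1 h1] with x hx
      by_cases hxΩ : x ∈ (Ω : Set R3)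
      · exact hx hxΩ
      · exact image_eq_zero_of_notMem_tsupport fun h' => hxΩ (h.classicalCurl.support h')
    exact congrFun ((h.classicalCurl.smooth.continuous.ae_eq_iff_eq _ continuous_const).1 h2)
  -- For the field `(f, 0, 0)` the component of the curl with index 1 is the derivative of `f` in
  -- direction 2. Its vanishing makes `f` constant along lines in that direction, against compact
  -- support and `f c = 1`.
  have hf0 : ∀ x, fderiv ℝ f x (EuclideanSpace.single 2 1) = 0 := by
    intro x
    have hd : HasFDerivAt f (fderiv ℝ f x) x := (hf.differentiable (by simp) x).hasFDerivAt
    have h1 : ∀ j, partialD j φ x =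
        (fderiv ℝ f x (EuclideanSpace.single j 1)) • (EuclideanSpace.single 0 (1 : ℂ) : C3) := by
      intro j
      rw [partialD, (hd.smul_const (EuclideanSpace.single 0 (1 : ℂ) : C3)).fderiv]
      rfl
    have h2 := congrArg (fun z : C3 => z 1) (hcurl x)
    simpa [classicalCurl, h1] using h2
  have hline : ∀ t : ℝ, f (c + t • EuclideanSpace.single 2 (1 : ℝ)) = 1 := by
    have hd : ∀ t : ℝ, HasDerivAt (fun t : ℝ => f (c + t • EuclideanSpace.single 2 (1 : ℝ))) 0 t := by
      intro t
      have h1 : HasDerivAt (fun t : ℝ => c + t • EuclideanSpace.single 2 (1 : ℝ))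
          (EuclideanSpace.single 2 (1 : ℝ)) t := by
        simpa using ((hasDerivAt_id t).smul_const (EuclideanSpace.single 2 (1 : ℝ))).const_add c
      have h2 := ((hf.differentiable (by simp) _).hasFDerivAt).comp_hasDerivAt t h1
      rwa [hf0] at h2
    intro t
    have := is_const_of_deriv_eq_zero (fun s => (hd s).differentiableAt)
      (fun s => (hd s).deriv) t 0
    simpa [hf1] using this
  obtain ⟨R, hR⟩ := hfc.isCompact.isBounded.exists_norm_le
  have hmem : c + (|R| + ‖c‖ + 1) • EuclideanSpace.single 2 (1 : ℝ) ∈ tsupport f := by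
    refine subset_tsupport _ ?_
    rw [Function.mem_support, hline]
    exact one_ne_zero
  have h1 := hR _ hmem
  have h2 := norm_sub_norm_le ((|R| + ‖c‖ + 1) • EuclideanSpace.single 2 (1 : ℝ)) (-c)
  have h3 : ‖(|R| + ‖c‖ + 1) • (EuclideanSpace.single 2 (1 : ℝ) : R3)‖ = |R| + ‖c‖ + 1 := by
    rw [norm_smul, Real.norm_of_nonneg (by positivity)]
    simp
  rw [h3, norm_neg, sub_neg_eq_add, add_comm _ c] at h2
  linarith [le_abs_self R]

/-- The curl of a test field is again a test field and divergence-free, so it lies in the form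
domain. -/
theorem rayleighSet_nonempty (hΩ : (Ω : Set R3).Nonempty) : (rayleighSet Ω).Nonempty := by
  obtain ⟨φ, h, hne⟩ := exists_test_curl_ne_zero hΩ
  have hmem : h.classicalCurl.toL2 ∈ Hdiv0 Ω := by
    have := curl_mem_Hdiv0 Ω ⟨h.toL2, h.mem_curl_domain⟩
    rwa [curl_eq_of_isWeakCurl ⟨h.toL2, h.mem_curl_domain⟩ h.isWeakCurl] at this
  set v := toGraphSpace ⟨_, h.classicalCurl.mem_curl0_domain⟩ hmem with hv
  refine ⟨_, ((‖h.classicalCurl.toL2‖⁻¹ : ℝ) : ℂ) • v, ?_, rfl⟩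
  rw [map_smul, norm_smul, hv, fieldMap_toGraphSpace]
  simp [hne]

theorem isLeast_spectrum (hΩ : (Ω : Set R3).Nonempty) :
    IsLeast {t : ℝ | (t : ℂ) ∈ opSpectrum (curlCurl0 Ω)} (sInf (rayleighSet Ω)) := by
  refine ⟨sInf_rayleighSet_mem_opSpectrum (rayleighSet_nonempty hΩ), fun t ht => ?_⟩
  by_contra hlt
  exact ht (boundedlyInvertible_of_notMem (Or.inr (not_le.1 hlt)))

theorem lambdaMin_eq (hΩ : (Ω : Set R3).Nonempty) : lambdaMin Ω = sInf (rayleighSet Ω) :=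
  (isLeast_spectrum hΩ).csInf_eq

end CurlCurl

/-! ### The resolvent set of the Maxwell pencil -/

section Pencil

open ContinuousLinearMap

/-- The Schur complement of the Maxwell pencil in the graph space of `curl₀`; `N` is the inverse
of the permeability. -/
noncomputable def maxwellSchur (N : L2 Ω →L[ℂ] L2 Ω) (ε σ : Coefficient Ω) (ω : ℂ) :
    graphSpace (⊤ : Submodule ℂ (L2 Ω)) →L[ℂ] graphSpace (⊤ : Submodule ℂ (L2 Ω)) :=
  schurOp (fieldMap ⊤) (curlMap ⊤) N ε.mulCLM σ.mulCLM ω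

theorem inner_maxwellSchur (N : L2 Ω →L[ℂ] L2 Ω) (ε σ : Coefficient Ω) (ω : ℂ)
    (u v : graphSpace (⊤ : Submodule ℂ (L2 Ω))) :
    ⟪u, maxwellSchur N ε σ ω v⟫_ℂ = ⟪curlMap ⊤ u, N (curlMap ⊤ v)⟫_ℂ -
      (ω ^ 2 * ⟪fieldMap ⊤ u, ε.mulOp (fieldMap ⊤ v)⟫_ℂ
        + Complex.I * ω * ⟪fieldMap ⊤ u, σ.mulOp (fieldMap ⊤ v)⟫_ℂ) := by
  refine (inner_schurOp _ _ _ _ _ _ u v).trans ?_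
  rw [inner_add_right, inner_smul_right, inner_smul_right]
  rfl

/-- The right-hand side `ω f + i curl μ⁻¹ g` of the reduced equation. -/
noncomputable def reducedSource (N : L2 Ω →L[ℂ] L2 Ω) (ω : ℂ) :
    L2Pair Ω →L[ℂ] graphSpace (⊤ : Submodule ℂ (L2 Ω)) :=
  adjoint (fieldMap ⊤) ∘L (ω • WithLp.fstL 2 ℂ (L2 Ω) (L2 Ω)) +
    adjoint (curlMap ⊤) ∘L (Complex.I • (N ∘L WithLp.sndL 2 ℂ (L2 Ω) (L2 Ω)))

theorem inner_reducedSource (N : L2 Ω →L[ℂ] L2 Ω) (ω : ℂ)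
    (v : graphSpace (⊤ : Submodule ℂ (L2 Ω))) (q : L2Pair Ω) :
    ⟪v, reducedSource N ω q⟫_ℂ =
      ω * ⟪fieldMap ⊤ v, q.fst⟫_ℂ + Complex.I * ⟪curlMap ⊤ v, N q.snd⟫_ℂ := by
  have h : reducedSource N ω q = adjoint (fieldMap ⊤) (ω • q.fst) +
      adjoint (curlMap ⊤) (Complex.I • N q.snd) := rfl
  rw [h, inner_add_right, adjoint_inner_right, adjoint_inner_right, inner_smul_right,
    inner_smul_right]

/-- The inverse is written down explicitly: `Q` solves the reduced equation for `E`, and `R₂`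
recovers `H` from the second row. -/
theorem boundedlyInvertible_pencil {ε μ σ : Coefficient Ω} {ω : ℂ} (hω : ω ≠ 0)
    {N : L2 Ω →L[ℂ] L2 Ω} (hN1 : ∀ u, μ.mulOp (N u) = u) (hN2 : ∀ u, N (μ.mulOp u) = u)
    (h : IsUnit (maxwellSchur N ε σ ω)) : BoundedlyInvertible (pencil ε μ σ ω) := by
  obtain ⟨U, hU⟩ := h
  set B : graphSpace (⊤ : Submodule ℂ (L2 Ω)) →L[ℂ] graphSpace (⊤ : Submodule ℂ (L2 Ω)) := ↑U⁻¹
    with hB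
  have h1 : ∀ u, maxwellSchur N ε σ ω (B u) = u := fun u => by
    rw [← hU]
    exact congrArg (fun T : _ →L[ℂ] graphSpace (⊤ : Submodule ℂ (L2 Ω)) => T u) U.mul_inv
  have h2 : ∀ u, B (maxwellSchur N ε σ ω u) = u := fun u => by
    rw [← hU]
    exact congrArg (fun T : _ →L[ℂ] graphSpace (⊤ : Submodule ℂ (L2 Ω)) => T u) U.inv_mul
  let Q : L2Pair Ω →L[ℂ] graphSpace (⊤ : Submodule ℂ (L2 Ω)) := B ∘L reducedSource N ω
  let R₂ : L2Pair Ω →L[ℂ] L2 Ω :=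
    (-ω⁻¹) • (N ∘L (Complex.I • (curlMap ⊤ ∘L Q) + WithLp.sndL 2 ℂ (L2 Ω) (L2 Ω)))
  have hR₂ : ∀ q, R₂ q = (-ω⁻¹) • N (Complex.I • curlMap ⊤ (Q q) + q.snd) := fun q => rfl
  let R : L2Pair Ω →L[ℂ] L2Pair Ω :=
    ((WithLp.prodContinuousLinearEquiv 2 ℂ (L2 Ω) (L2 Ω)).symm : _ →L[ℂ] L2Pair Ω) ∘L
      ((fieldMap ⊤ ∘L Q).prod R₂)
  have hR : ∀ q, R q = WithLp.toLp 2 (fieldMap ⊤ (Q q), R₂ q) := fun q => rfl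
  have hleft : ∀ x : (pencil ε μ σ ω).domain, (x : L2Pair Ω) = R (pencil ε μ σ ω x) := by
    intro x
    set u : graphSpace (⊤ : Submodule ℂ (L2 Ω)) := toGraphSpace ⟨_, x.2.1⟩ trivial with hu
    have hfst : (pencil ε μ σ ω x).fst = -Complex.I • σ.mulOp (fieldMap ⊤ u)
        + Complex.I • curl Ω ⟨x.1.snd, x.2.2⟩ - ω • ε.mulOp (fieldMap ⊤ u) := rfl
    have hsnd : (pencil ε μ σ ω x).snd = -Complex.I • curlMap ⊤ u - ω • μ.mulOp x.1.snd := rfl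
    have hNs : N (pencil ε μ σ ω x).snd = -Complex.I • N (curlMap ⊤ u) - ω • x.1.snd := by
      rw [hsnd, map_sub, map_smul, map_smul, hN2]
    have hQ : Q (pencil ε μ σ ω x) = u := by
      have : reducedSource N ω (pencil ε μ σ ω x) = maxwellSchur N ε σ ω u := by
        refine ext_inner_left ℂ fun v => ?_
        rw [inner_reducedSource, inner_maxwellSchur, hNs, hfst]
        simp only [inner_add_right, inner_sub_right, inner_smul_right]
        rw [← inner_curlMap v ⟨x.1.snd, x.2.2⟩]
        linear_combination (-⟪curlMap ⊤ v, N (curlMap ⊤ u)⟫_ℂ) * Complex.I_sq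
      exact (congrArg B this).trans (h2 u)
    rw [hR, hR₂, hQ, map_add, hNs, map_smul]
    refine congrArg (WithLp.toLp 2) (Prod.ext rfl ?_)
    change x.1.snd = _
    match_scalars
    all_goals field_simp
    ring
  refine ⟨⟨fun x y hxy => ?_, fun q => ?_⟩, ‖R‖, fun x => ?_⟩
  · refine Subtype.ext ?_
    rw [hleft x, hleft y]
    exact congrArg R hxy
  · have hQ : maxwellSchur N ε σ ω (Q q) = reducedSource N ω q := h1 _
    set u := Q q with hu
    -- The first row solved for `curl H`; the reduced equation says precisely that this is the weak
    -- curl of `R₂ q`.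
    have hw : IsWeakCurl Ω (R₂ q) (-Complex.I • (q.fst + Complex.I • σ.mulOp (fieldMap ⊤ u)
        + ω • ε.mulOp (fieldMap ⊤ u))) := by
      refine isWeakCurl_of_forall_graphSpace fun v => ?_
      have h3 : ⟪v, maxwellSchur N ε σ ω u⟫_ℂ = ⟪v, reducedSource N ω q⟫_ℂ := by rw [hQ]
      rw [inner_reducedSource, inner_maxwellSchur] at h3
      rw [hR₂, map_add, map_smul]
      simp only [inner_add_right, inner_smul_right]
      rw [← hu]
      field_simp
      linear_combination (-Complex.I) * h3 - ⟪curlMap ⊤ v, N q.snd⟫_ℂ * Complex.I_sq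
    have hd : R₂ q ∈ (curl Ω).domain := mem_curl_domain.2 ⟨_, hw⟩
    refine ⟨⟨WithLp.toLp 2 (fieldMap ⊤ u, R₂ q), ⟨fieldMap_mem_domain u, hd⟩⟩, ?_⟩
    refine congrArg (WithLp.toLp 2) (Prod.ext ?_ ?_)
    · change -Complex.I • σ.mulOp (fieldMap ⊤ u) + Complex.I • curl Ω ⟨R₂ q, hd⟩
        - ω • ε.mulOp (fieldMap ⊤ u) = q.fst
      rw [curl_eq_of_isWeakCurl ⟨R₂ q, hd⟩ hw]
      match_scalars
      · linear_combination (-Complex.I) * Complex.I_sq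
      · linear_combination (-1) * Complex.I_sq
      · linear_combination (-ω) * Complex.I_sq
    · change -Complex.I • curl0 Ω ⟨fieldMap ⊤ u, fieldMap_mem_domain u⟩ - ω • μ.mulOp (R₂ q)
        = q.snd
      rw [curl0_fieldMap, hR₂, map_smul, hN1]
      match_scalars
      all_goals field_simp
      ring
  · have := R.le_opNorm (pencil ε μ σ ω x)
    rwa [← hleft x] at this

end Pencil

/-! ### The spectral enclosure -/

section Enclosure

theorem exists_kernel_correction (v : graphSpace (⊤ : Submodule ℂ (L2 Ω))) :
    ∃ g, curlMap ⊤ g = 0 ∧ ‖g‖ ≤ ‖v‖ ∧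
      sInf (rayleighSet Ω) * ‖fieldMap ⊤ v - fieldMap ⊤ g‖ ^ 2 ≤ ‖curlMap ⊤ v‖ ^ 2 := by
  obtain ⟨g, v₀, hg, hn, -, hf, hc⟩ := exists_helmholtz v
  refine ⟨g, hg, hn, ?_⟩
  rw [← hf, ← hc]
  exact sInf_rayleighSet_mul_le v₀

/-- The set that encloses the spectrum of the Maxwell pencil; `S` is the largest possible quotient
of conductivity and permittivity, `s` the smallest one. -/
def enclosure (S s l : ℝ) : Set ℂ :=
  {ω : ℂ | ω.re = 0 ∧ ω.im ∈ Set.Icc (-S) 0} ∪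
    {ω : ℂ | ω.re ≠ 0 ∧ ω.im ∈ Set.Icc (-(1 / 2 * S)) (-(1 / 2 * s)) ∧
      l ≤ ω.re ^ 2 - 3 * ω.im ^ 2 + 2 * S * |ω.im|}

/-- Reflection in the imaginary axis changes only the sign of `Re ω`; this transfers the lower bound
to the adjoint. -/
theorem neg_conj_mem_enclosure {S s l : ℝ} {ω : ℂ}
    (h : -(starRingEnd ℂ) ω ∈ enclosure S s l) : ω ∈ enclosure S s l := by
  simpa [enclosure] using h

theorem pencilSpectrum_subset (hΩ : (Ω : Set R3).Nonempty) (ε μ σ : Coefficient Ω)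
    {εmin εmax μmin μmax σmin σmax : ℝ}
    (hεmin : 0 < εmin) (hε : ε.BoundedBy εmin εmax)
    (hμmin : 0 < μmin) (hμ : μ.BoundedBy μmin μmax)
    (hσmin : 0 ≤ σmin) (hσ : σ.BoundedBy σmin σmax) :
    pencilSpectrum (pencil ε μ σ) ⊆
      enclosure (σmax / εmin) (σmin / εmax) (sInf (rayleighSet Ω) / (εmax * μmax)) := by
  have hεmax : 0 < εmax := hεmin.trans_le (hε.le hΩ)
  have hμmax : 0 < μmax := hμmin.trans_le (hμ.le hΩ)
  have hσmax : 0 ≤ σmax := hσmin.trans (hσ.le hΩ)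
  have bε := Coefficient.symmBounds_mulCLM hε
  have bσ := Coefficient.symmBounds_mulCLM hσ
  obtain ⟨N, hN1, hN2, hNs, hN⟩ := (Coefficient.symmBounds_mulCLM hμ).exists_inverse hμmin
  have key : ∀ ω ∉ enclosure (σmax / εmin) (σmin / εmax) (sInf (rayleighSet Ω) / (εmax * μmax)),
      ∃ c > 0, ∀ u, c * ‖u‖ ≤ ‖maxwellSchur N ε σ ω u‖ := by
    intro ω hω
    by_cases hre : ω.re = 0
    · refine le_norm_schurOp_of_re_eq_zero norm_sq_graphSpace hN hμmax hεmin bε hσmin hσmax bσ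
        hre ?_
      by_contra hcon
      rw [not_or, not_lt, not_lt] at hcon
      exact hω (Or.inl ⟨hre, hcon.2, hcon.1⟩)
    · refine le_norm_schurOp_of_re_ne_zero norm_sq_graphSpace hNs hN hμmax hεmin hεmax bε hσmin
        hσmax bσ sInf_rayleighSet_nonneg exists_kernel_correction hre fun hcon => ?_
      exact hω (Or.inr ⟨hre, hcon⟩)
  intro ω hω
  by_contra hout
  refine hω (boundedlyInvertible_pencil (N := N) ?_ hN1 hN2 ?_)
  -- The point `0` always belongs to the enclosure, so the elimination of `H` is legitimate outside
  -- it.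
  · rintro rfl
    refine hout (Or.inl ⟨rfl, ?_, le_rfl⟩)
    exact neg_nonpos.2 (div_nonneg hσmax hεmin.le)
  · exact isUnit_of_bounded_below _ (maxwellSchur N ε σ (-(starRingEnd ℂ) ω))
      (schurOp_adjoint _ _ hNs bε.symm bσ.symm ω) (key ω hout)
      (key _ fun h => hout (neg_conj_mem_enclosure h))

theorem exists_separation {A : Set ℂ} {S s l : ℝ} (hl : S ^ 2 / 3 < l)
    (hA : A ⊆ enclosure S s l) :
    ∃ δ : ℝ, 0 < δ ∧ ∀ z ∈ A ∩ {ω : ℂ | ω.re = 0}, ∀ w ∈ A \ {ω : ℂ | ω.re = 0},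
      δ ≤ dist z w := by
  refine ⟨√(l - S ^ 2 / 3), Real.sqrt_pos.2 (sub_pos.2 hl), ?_⟩
  rintro z ⟨-, hz⟩ w ⟨hwA, hw⟩
  rcases hA hwA with h | ⟨-, -, h⟩
  · exact absurd h.1 hw
  -- Completing the square: `3 y² - 2 S y + S² / 3 = (3y - S)² / 3 ≥ 0` with `y = |Im w|`.
  have h1 : l - S ^ 2 / 3 ≤ w.re ^ 2 := by
    nlinarith [sq_nonneg (3 * |w.im| - S), sq_abs w.im]
  have h2 : |w.re| ≤ dist z w := by
    rw [dist_comm, Complex.dist_eq]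
    have := Complex.abs_re_le_norm (w - z)
    rwa [Complex.sub_re, show z.re = 0 from hz, sub_zero] at this
  exact (Real.sqrt_le_sqrt h1).trans (by rwa [Real.sqrt_sq_eq_abs])

theorem inter_real_gap_eq_empty {A : Set ℂ} {S s l : ℝ} (hA : A ⊆ enclosure S s l) :
    A ∩ (fun t : ℝ => (t : ℂ)) '' (Set.Ioo (-√l) 0 ∪ Set.Ioo 0 √l) = ∅ := by
  rw [Set.eq_empty_iff_forall_notMem]
  rintro _ ⟨hz, t, ht, rfl⟩
  have ht0 : t ≠ 0 := by
    rcases ht with h | h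
    · exact h.2.ne
    · exact h.1.ne'
  have htl : t ^ 2 < l := by
    have h1 : |t| < √l := by
      rcases ht with h | h
      · exact abs_lt.2 ⟨h.1, h.2.trans (lt_trans (neg_pos.2 h.2) (by linarith [h.1]))⟩
      · exact abs_lt.2 ⟨by linarith [h.1, h.2], h.2⟩
    have h2 := (Real.lt_sqrt (abs_nonneg t)).1 h1
    rwa [sq_abs] at h2
  rcases hA hz with h | ⟨-, -, h⟩
  · exact ht0 h.1
  · simp at h
    linarith

end Enclosure

end Maxwell

/-! ### The main theorem. -/

theorem theorem2p1 (Ω : TopologicalSpace.Opens Maxwell.R3)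
    (hΩ : (Ω : Set Maxwell.R3).Nonempty)
    (ε μ σ : Maxwell.Coefficient Ω)
    (εmin εmax μmin μmax σmin σmax : ℝ)
    (hεmin : 0 < εmin) (hε : ε.BoundedBy εmin εmax)
    (hμmin : 0 < μmin) (hμ : μ.BoundedBy μmin μmax)
    (hσmin : 0 ≤ σmin) (hσ : σ.BoundedBy σmin σmax) :
    -- `lambdaMin Ω` is the minimum of the (real) spectrum, and it is non-negative
    (((Maxwell.lambdaMin Ω : ℝ) : ℂ) ∈ Maxwell.opSpectrum (Maxwell.curlCurl0 Ω) ∧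
      (∀ z ∈ Maxwell.opSpectrum (Maxwell.curlCurl0 Ω),
        z.im = 0 ∧ Maxwell.lambdaMin Ω ≤ z.re) ∧
      0 ≤ Maxwell.lambdaMin Ω) ∧
    -- the spectral enclosure
    Maxwell.pencilSpectrum (Maxwell.pencil ε μ σ) ⊆
      {ω : ℂ | ω.re = 0 ∧ ω.im ∈ Set.Icc (-(σmax / εmin)) 0} ∪
      {ω : ℂ | ω.re ≠ 0 ∧
        ω.im ∈ Set.Icc (-(1 / 2 * (σmax / εmin))) (-(1 / 2 * (σmin / εmax))) ∧
        Maxwell.lambdaMin Ω / (εmax * μmax) ≤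
          ω.re ^ 2 - 3 * ω.im ^ 2 + 2 * (σmax / εmin) * |ω.im|} ∧
    -- the gaps on the real axis
    (0 < Maxwell.lambdaMin Ω →
      Maxwell.pencilSpectrum (Maxwell.pencil ε μ σ) ∩
        (fun t : ℝ => (t : ℂ)) ''
          (Set.Ioo (-√(Maxwell.lambdaMin Ω / (εmax * μmax))) 0 ∪
            Set.Ioo 0 √(Maxwell.lambdaMin Ω / (εmax * μmax))) = ∅) ∧
    -- the part on the imaginary axis has a positive distance from the rest
    (1 / 3 * (σmax ^ 2 * εmax * μmax / εmin ^ 2) < Maxwell.lambdaMin Ω →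
      Maxwell.pencilSpectrum (Maxwell.pencil ε μ σ) ∩ {ω : ℂ | ω.re = 0} ⊆
        {ω : ℂ | ω.re = 0 ∧ ω.im ∈ Set.Icc (-(σmax / εmin)) 0} ∧
      ∃ δ : ℝ, 0 < δ ∧
        ∀ z ∈ Maxwell.pencilSpectrum (Maxwell.pencil ε μ σ) ∩ {ω : ℂ | ω.re = 0},
          ∀ w ∈ Maxwell.pencilSpectrum (Maxwell.pencil ε μ σ) \ {ω : ℂ | ω.re = 0},
            δ ≤ dist z w) := by
  have hsub := Maxwell.pencilSpectrum_subset hΩ ε μ σ hεmin hε hμmin hμ hσmin hσ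
  have hεmax : 0 < εmax := hεmin.trans_le (hε.le hΩ)
  have hμmax : 0 < μmax := hμmin.trans_le (hμ.le hΩ)
  rw [Maxwell.lambdaMin_eq hΩ]
  refine ⟨⟨Maxwell.sInf_rayleighSet_mem_opSpectrum (Maxwell.rayleighSet_nonempty hΩ),
    fun z hz => ?_, Maxwell.sInf_rayleighSet_nonneg⟩, hsub,
    fun _ => Maxwell.inter_real_gap_eq_empty hsub, fun hl => ⟨?_, ?_⟩⟩
  · constructor <;> by_contra hcon
    · exact hz (Maxwell.boundedlyInvertible_of_notMem (Or.inl hcon))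
    · exact hz (Maxwell.boundedlyInvertible_of_notMem (Or.inr (not_le.1 hcon)))
  · rintro z ⟨hz, hre⟩
    rcases hsub hz with h | h
    · exact h
    · exact absurd hre h.1
  · refine Maxwell.exists_separation ?_ hsub
    -- With `S = σmax / εmin` and `l = λmin / (εmax μmax)`, the hypothesis on `λmin` is `S² / 3 <
    -- l`.
    rw [lt_div_iff₀ (by positivity)]
    refine lt_of_eq_of_lt ?_ hl
    field_simp
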